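/- Consider $n$ buyers with independent discrete private values: buyer $i$ has values $0\le v_i^1<\dots<v_i^{d_i}$ ($d_i\ge 1$), each with positive probability; let $G_i$ be the distribution function of his value, and put $G_i(v_i^0)=0$. Given a guess $\bar b\ge 0$ of the largest winning bid in the first-price auction, run the following backward-shooting algorithm. Its state is a current bid $b$, a bidding set $\Lambda$ of buyers, the largest unconsumed value $v_i=v_i^{k_i}$ of every buyer, and numbers $F_i=F_i(b)$; for $|\Lambda|\ge 2$ put $$h_i(x)=\frac1{|\Lambda|-1}\sum_{j\in\Lambda}\frac1{v_j-x}-\frac1{v_i-x}.$$ *Entering.* At bid $x$, a buyer $i\notin\Lambda$ with the largest unconsumed value among the buyers outside $\Lambda$ enters $\Lambda$ if $v_i>x$ and ($|\Lambda|\le 1$ or $h_i(x)\ge 0$). *Leaving.* Below the current bid, as long as $\Lambda$ does not change, $F_i$ solves $F_i'/F_i=h_i$ for $i\in\Lambda$ and is constant for $i\notin\Lambda$. A buyer $i\in\Lambda$ leaves at $x$ when $F_i(x)=G_i(v_i^{k_i-1})$; then $v_i^{k_i}$ is consumed and $k_i$ decreases by one. *Algorithm.* Start with $b=\bar b$, $k_i=d_i$,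 $F_i=1$, $\Lambda=\emptyset$, and add buyers as long as one enters. While $|\Lambda|\ge 2$ and $b>0$: replace $b$ by the largest bid in $[0,b)$ at which a buyer leaves or enters $\Lambda$ (by $0$ if there is none), update $F_i$, remove all buyers who leave there, and then add buyers as long as one enters. Return $\underline b(\bar b)=b$. Say that the algorithm *stops* on $\bar b$ if the loop ends with $|\Lambda|\le 1$, so that no further buyer can join; otherwise it has run down to bid $0$ with $|\Lambda|\ge 2$ and $\underline b(\bar b)=0$. Then the algorithm terminates on every guess $\bar b\ge 0$, and the position $\underline b(\bar b)$ is strictly monotone in the guess: 1. $\underline b$ is strictly increasing on the set of guesses on which the algorithm stops. If the algorithm stops on a guess, it stops on every larger guess; on a guess on which it does not stop, $\underline b(\bar b)=0$. In particular, for all guesses $0\le\bar b_1<\bar b_2$ with $\underline b(\bar b_2)>0$, one has $\underline b(\bar b_1)<\underline b(\bar b_2)$. 2. Hence at most one guess can match the true smallest winning bid: for every $\beta>0$ there is at most one guess $\bar b\ge0$ with $\underline b(\bar b)=\beta$, and for every real $\beta$ there is at most one guess $\bar b\ge 0$ on which the algorithm stops at $\underline b(\bar b)=\beta$. -/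

import Mathlib

noncomputable section

/-- A first-price auction with `n` buyers and independent discrete private values.
Buyer `i` has the `d i ≥ 1` possible values `value i 1 < … < value i (d i)`, the smallest of which is
nonnegative; `value i j` has probability `prob i j > 0`. Only indices `1 ≤ j ≤ d i` are meaningful. -/
structure Auction (n : ℕ) where
  d : Fin n → ℕ
  value : Fin n → ℕ → ℝ
  prob : Fin n → ℕ → ℝ
  one_le_d : ∀ i, 1 ≤ d i
  value_nonneg : ∀ i, 0 ≤ value i 1
  value_lt : ∀ i j, 1 ≤ j → j < d i → value i j < value i (j + 1)
  prob_pos : ∀ i j, 1 ≤ j → j ≤ d i → 0 < prob i j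
  prob_sum : ∀ i, ∑ j ∈ Finset.Icc 1 (d i), prob i j = 1

/-- The state of the backward-shooting algorithm at the current bid `bid`. -/
structure ShootState (n : ℕ) where
  /-- the current bid `b` -/
  bid : ℝ
  /-- the bidding set `Λ(b)`; the waiting list is its complement -/
  bidders : Finset (Fin n)
  /-- the index of the largest value of each buyer that is not yet consumed -/
  level : Fin n → ℕ
  /-- `F i = F_i(b)`, the cumulative bid distribution function of buyer `i` at the bid `b` -/
  F : Fin n → ℝ

/-- `h_i(x) = (1 / (|Λ| - 1)) ∑_{j ∈ Λ} 1 / (v_j - x) - 1 / (v_i - x)`, which is the logarithmic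
derivative of the bid distribution `F_i` while the bidding set is `Λ` with values `v`. -/
def hazard {n : ℕ} (v : Fin n → ℝ) (L : Finset (Fin n)) (i : Fin n) (x : ℝ) : ℝ :=
  (1 / ((L.card : ℝ) - 1)) * (∑ j ∈ L, 1 / (v j - x)) - 1 / (v i - x)

/-- `H_i(x) = ln (v_i - x) - (1 / (|Λ| - 1)) ∑_{j ∈ Λ} ln (v_j - x)`, a primitive of `h_i`. -/
def hazardPrimitive {n : ℕ} (v : Fin n → ℝ) (L : Finset (Fin n)) (i : Fin n) (x : ℝ) : ℝ :=
  Real.log (v i - x) - (1 / ((L.card : ℝ) - 1)) * ∑ j ∈ L, Real.log (v j - x)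

theorem hasDerivAt_hazardPrimitive {n : ℕ} (v : Fin n → ℝ) (L : Finset (Fin n)) (i : Fin n) (x : ℝ)
    (hi : x < v i) (hL : ∀ j ∈ L, x < v j) :
    HasDerivAt (hazardPrimitive v L i) (hazard v L i x) x := by
  have key : ∀ j, x < v j → HasDerivAt (fun y => Real.log (v j - y)) (-1 / (v j - x)) x := by
    intro j hj
    have h1 : HasDerivAt (fun y : ℝ => v j - y) (-1) x := by
      simpa using (hasDerivAt_id x).const_sub (v j)
    exact h1.log (by linarith)
  have hs : HasDerivAt (fun y => ∑ j ∈ L, Real.log (v j - y)) (∑ j ∈ L, -1 / (v j - x)) x :=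
    HasDerivAt.fun_sum fun j hj => key j (hL j hj)
  have hmain := (key i hi).sub (hs.const_mul (1 / ((L.card : ℝ) - 1)))
  have he : -1 / (v i - x) - 1 / ((L.card : ℝ) - 1) * ∑ j ∈ L, -1 / (v j - x) = hazard v L i x := by
    simp only [hazard, neg_div, Finset.sum_neg_distrib]
    ring
  rw [he] at hmain
  exact hmain

/-- Buyer `i` enters the bidding set `Λ` from the waiting list at the bid `x`: he has the largest
unconsumed value in the waiting list, this value exceeds `x`, and either `|Λ| ≤ 1` or
`1 / (v_i - x) ≤ (1 / (|Λ| - 1)) ∑_{j ∈ Λ} 1 / (v_j - x)`. -/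
def Enters {n : ℕ} (v : Fin n → ℝ) (L : Finset (Fin n)) (x : ℝ) (i : Fin n) : Prop :=
  i ∉ L ∧ (∀ j, j ∉ L → v j ≤ v i) ∧ x < v i ∧ (L.card ≤ 1 ∨ 0 ≤ hazard v L i x)

open Classical in
/-- Add one buyer who enters, if there is one (ties between equal values are broken arbitrarily). -/
def addOne {n : ℕ} (v : Fin n → ℝ) (x : ℝ) (L : Finset (Fin n)) : Finset (Fin n) :=
  if h : ∃ i, Enters v L x i then insert h.choose L else L

/-- Add buyers repeatedly until none enters; as there are `n` buyers, `n` rounds are enough. -/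
def addBuyers {n : ℕ} (v : Fin n → ℝ) (x : ℝ) (L : Finset (Fin n)) : Finset (Fin n) :=
  (addOne v x)^[n] L

namespace Auction

variable {n : ℕ} (A : Auction n)

/-- `G_i(v_i^k)`, the probability that the value of buyer `i` is at most his `k`-th value;
it is `0` for `k = 0`. -/
def cdf (i : Fin n) (k : ℕ) : ℝ := ∑ j ∈ Finset.Icc 1 k, A.prob i j

/-- The largest unconsumed value of each buyer. -/
def cur (s : ShootState n) (i : Fin n) : ℝ := A.value i (s.level i)

/-- The bid distribution function at a bid `y ≤ b`, computed on the assumption that the bidding set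
does not change between `y` and `b`: `ln F_i(b) - ln F_i(y) = H_i(b) - H_i(y)` for `i ∈ Λ`, while
`F_i` is constant for `i` in the waiting list. -/
def extendF (s : ShootState n) (y : ℝ) (i : Fin n) : ℝ :=
  if i ∈ s.bidders then
    s.F i * Real.exp
      (hazardPrimitive (A.cur s) s.bidders i y - hazardPrimitive (A.cur s) s.bidders i s.bid)
  else s.F i

/-- Buyer `i` in the bidding set leaves at `y`: the probability of his current value is used up. -/
def LeavesAt (s : ShootState n) (y : ℝ) (i : Fin n) : Prop :=
  i ∈ s.bidders ∧ A.extendF s y i = A.cdf i (s.level i - 1)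

/-- The bidding set changes at `y`: some buyer leaves it or some waiting buyer enters it. -/
def ChangesAt (s : ShootState n) (y : ℝ) : Prop :=
  (∃ i, A.LeavesAt s y i) ∨ ∃ i, Enters (A.cur s) s.bidders y i

/-- The next position below the current bid: the largest nonnegative bid at which the bidding set
changes, or the bid `0` if there is no change at a nonnegative bid. -/
def nextBid (s : ShootState n) : ℝ :=
  sSup {y : ℝ | 0 ≤ y ∧ y < s.bid ∧ (y = 0 ∨ A.ChangesAt s y)}

/-- The loop condition `|Λ(b)| ≥ 2` and `b > 0`. -/
def Running (s : ShootState n) : Prop := 2 ≤ s.bidders.card ∧ 0 < s.bid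

open Classical in
/-- One pass through the loop: move to the next position, remove the buyers who leave there
(their next smaller value becomes the largest unconsumed one), then add the buyers who enter. -/
def step (s : ShootState n) : ShootState n :=
  let y := A.nextBid s
  let level' : Fin n → ℕ := fun i => if A.LeavesAt s y i then s.level i - 1 else s.level i
  { bid := y
    bidders := addBuyers (fun i => A.value i (level' i)) y
      (s.bidders.filter fun i => ¬ A.LeavesAt s y i)
    level := level'
    F := A.extendF s y }

/-- The state before the loop, for the guess `g` of the largest winning bid. -/
def start (g : ℝ) : ShootState n where
  bid := g
  bidders := addBuyers (fun i => A.value i (A.d i)) g ∅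
  level := A.d
  F := fun _ => 1

/-- The algorithm terminates on the guess `g`. -/
def Terminates (g : ℝ) : Prop := ∃ N : ℕ, ¬ Running (A.step^[N] (A.start g))

/-- The state in which the loop is left (meaningful if the algorithm terminates on `g`). -/
def final (g : ℝ) : ShootState n :=
  A.step^[sInf {N : ℕ | ¬ Running (A.step^[N] (A.start g))}] (A.start g)

/-- The output of the algorithm on the guess `g`: the bid at which the loop is left. -/
def lowBid (g : ℝ) : ℝ := (A.final g).bid

/-- On the guess `g` the algorithm stops because at most one buyer is left in the bidding set and
no other buyer can join it (and not merely because the bids have run down to `0`). -/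
def Stops (g : ℝ) : Prop := A.Terminates g ∧ (A.final g).bidders.card ≤ 1

end Auction

end

/-! Two runs are compared at a common bid `x`: `s₂` from the larger guess and `s₁` from the smaller.
The claim is that the `F_i` of `s₂` stay below those of `s₁`, strictly enough that `s₂` stops
strictly earlier, if it stops.

Write `r = (∑_{j ∈ Λ} 1 / (v_j - x)) / (|Λ| - 1)`, so that `F_i' / F_i = r - 1 / (v_i - x)` on `Λ`.
For `|Λ| ≥ 2`, the entering rule makes `Λ` the set of buyers with value above `x` and `1 / (v_i - x)
≤ r`. This choice minimizes `r` over all sets of at least two buyers with values above `x`, and the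
minimum cannot fall when values fall (`bidRate_sum_le`). Smaller `F_i` mean smaller current values,
hence a larger rate, hence a faster relative decrease of `F_i` as the bid runs down. So the order of
the `F_i` reproduces itself (`IsBelow.extendF_le`).

Strictness is carried by two bidders of `s₂` with strictly smaller `F`, or by a buyer with a
strictly larger value in `s₁` that makes the rate there strictly smaller (`IsStrictlyBelow`). Two
such bidders have values above the bid in `s₁` as well, so at least two buyers bid in `s₁` too: the
run from the smaller guess is alive whenever the other one was alive just above
(`IsValid.isStrictlyBelow_moveTo`). The comparison starts at the smaller guess `g₁`, where the run
from `g₁` has all `F_i = 1` while the bidders of the other run have already dropped below `1`.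
Induction on the number of remaining changes compares the outcomes (`IsBelow.isLargerOutcome`). -/

noncomputable section

/-! ### Weight inequalities behind nonnegative hazard rates -/

section Weights

variable {ι : Type*} {c c' : ι → ℝ} {L M R : Finset ι}

/-- It suffices to treat the maximal weight `c k`. Deleting `L \ R` lowers the left side by `|L \ R|
* c k` and the right side by at most that. -/
theorem card_sub_one_mul_le_sum_of_subset (hR : R ⊆ L) (hc : ∀ i ∈ L, 0 ≤ c i)
    (h : ∀ i ∈ L, ((L.card : ℝ) - 1) * c i ≤ ∑ j ∈ L, c j) {j : ι} (hj : j ∈ L) :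
    ((R.card : ℝ) - 1) * c j ≤ ∑ i ∈ R, c i := by
  classical
  obtain ⟨k, hk, hmax⟩ := L.exists_max_image c ⟨j, hj⟩
  have hsplit := Finset.sum_sdiff (f := c) hR
  have hbound : ∑ i ∈ L \ R, c i ≤ ((L \ R).card : ℝ) * c k := by
    rw [← nsmul_eq_mul]
    exact Finset.sum_le_card_nsmul _ _ _ fun i hi => hmax i (Finset.mem_sdiff.1 hi).1
  have hcard : ((L \ R).card : ℝ) = L.card - R.card := by
    rw [Finset.card_sdiff_of_subset hR, Nat.cast_sub (Finset.card_le_card hR)]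
  rw [hcard] at hbound
  have hkL := h k hk
  rcases R.eq_empty_or_nonempty with rfl | hne
  · simpa using hc j hj
  · have h1 : (1 : ℝ) ≤ R.card := by exact_mod_cast hne.card_pos
    have h2 : ((R.card : ℝ) - 1) * c j ≤ ((R.card : ℝ) - 1) * c k :=
      mul_le_mul_of_nonneg_left (hmax j hj) (by linarith)
    nlinarith

/-- After dropping members of `L`, raising the kept weights only helps, and each newcomer adds `c j`
on the left and at least `c j` on the right. With `c i = 1 / (v_i - x)` this covers departures,
falling values, and entrants with values at most `v_j`. -/
theorem card_sub_one_mul_le_sum (hc : ∀ i ∈ L, 0 ≤ c i)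
    (h : ∀ i ∈ L, ((L.card : ℝ) - 1) * c i ≤ ∑ j ∈ L, c j) {j : ι} (hj : j ∈ L)
    (hin : ∀ i ∈ M, i ∈ L → c i ≤ c' i) (hout : ∀ i ∈ M, i ∉ L → c j ≤ c' i) :
    ((M.card : ℝ) - 1) * c j ≤ ∑ i ∈ M, c' i := by
  classical
  have h1 := card_sub_one_mul_le_sum_of_subset (R := M.filter (· ∈ L))
    (fun i hi => (Finset.mem_filter.1 hi).2) hc h hj
  have h2 : ∑ i ∈ M.filter (· ∈ L), c i ≤ ∑ i ∈ M.filter (· ∈ L), c' i :=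
    Finset.sum_le_sum fun i hi => hin i (Finset.mem_filter.1 hi).1 (Finset.mem_filter.1 hi).2
  have h3 : ((M.filter (· ∉ L)).card : ℝ) * c j ≤ ∑ i ∈ M.filter (· ∉ L), c' i := by
    rw [← nsmul_eq_mul]
    exact Finset.card_nsmul_le_sum _ _ _ fun i hi =>
      hout i (Finset.mem_filter.1 hi).1 (Finset.mem_filter.1 hi).2
  have h4 := Finset.sum_filter_add_sum_filter_not M (· ∈ L) c'
  have h5 : ((M.filter (· ∈ L)).card : ℝ) + (M.filter (· ∉ L)).card = M.card := by
    exact_mod_cast Finset.card_filter_add_card_filter_not (s := M) (· ∈ L)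
  rw [← h5]
  linarith

end Weights

/-! ### The bid rate of feasible and saturated bidding sets -/

variable {n : ℕ} {v v₁ v₂ : Fin n → ℝ} {L L₁ L₂ : Finset (Fin n)} {x z : ℝ} {i u : Fin n}

/-- The common part `(1 / (|Λ| - 1)) ∑_{j ∈ Λ} 1 / (v_j - x)` of the hazard rates. -/
def bidRate (v : Fin n → ℝ) (L : Finset (Fin n)) (x : ℝ) : ℝ :=
  (∑ j ∈ L, (v j - x)⁻¹) / ((L.card : ℝ) - 1)

theorem hazard_eq_bidRate_sub (v : Fin n → ℝ) (L : Finset (Fin n)) (i : Fin n) (x : ℝ) :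
    hazard v L i x = bidRate v L x - (v i - x)⁻¹ := by
  simp only [hazard, bidRate, one_div]
  ring

/-- All buyers of the bidding set have values above the bid and nonnegative hazard rates. -/
structure IsFeasible (v : Fin n → ℝ) (L : Finset (Fin n)) (x : ℝ) : Prop where
  lt : ∀ i ∈ L, x < v i
  le : ∀ i ∈ L, ((L.card : ℝ) - 1) * (v i - x)⁻¹ ≤ ∑ j ∈ L, (v j - x)⁻¹

/-- No buyer outside of the bidding set would like to join it. -/
def IsSaturated (v : Fin n → ℝ) (L : Finset (Fin n)) (x : ℝ) : Prop :=
  ∀ i ∉ L, x < v i → 2 ≤ L.card ∧ ∑ j ∈ L, (v j - x)⁻¹ < ((L.card : ℝ) - 1) * (v i - x)⁻¹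

theorem cast_card_sub_one_pos (h : 2 ≤ L.card) : 0 < (L.card : ℝ) - 1 := by
  have : (2 : ℝ) ≤ L.card := by exact_mod_cast h
  linarith

theorem inv_le_bidRate_iff (h : 2 ≤ L.card) {a : ℝ} :
    a ≤ bidRate v L x ↔ ((L.card : ℝ) - 1) * a ≤ ∑ j ∈ L, (v j - x)⁻¹ := by
  rw [bidRate, le_div_iff₀' (cast_card_sub_one_pos h)]

theorem inv_lt_bidRate_iff (h : 2 ≤ L.card) {a : ℝ} :
    a < bidRate v L x ↔ ((L.card : ℝ) - 1) * a < ∑ j ∈ L, (v j - x)⁻¹ := by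
  rw [bidRate, lt_div_iff₀' (cast_card_sub_one_pos h)]

theorem bidRate_lt_iff (h : 2 ≤ L.card) {a : ℝ} :
    bidRate v L x < a ↔ ∑ j ∈ L, (v j - x)⁻¹ < ((L.card : ℝ) - 1) * a := by
  rw [bidRate, div_lt_iff₀' (cast_card_sub_one_pos h)]

/-- Written as total excess over the rate, the definition of the rate can be compared between two
bidding sets term by term. -/
theorem sum_inv_sub_bidRate (h : 2 ≤ L.card) :
    ∑ j ∈ L, ((v j - x)⁻¹ - bidRate v L x) = - bidRate v L x := by
  have := (cast_card_sub_one_pos h).ne'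
  rw [Finset.sum_sub_distrib, Finset.sum_const, nsmul_eq_mul, bidRate]
  field_simp
  ring

theorem IsSaturated.not_enters (hs : IsSaturated v L x) (i : Fin n) : ¬ Enters v L x i := by
  rintro ⟨hi, -, hx, h⟩
  obtain ⟨hc, hlt⟩ := hs i hi hx
  rw [← bidRate_lt_iff hc] at hlt
  rw [hazard_eq_bidRate_sub] at h
  rcases h with h | h
  · omega
  · linarith

theorem isSaturated_of_not_enters (h : ∀ i, ¬ Enters v L x i) : IsSaturated v L x := by
  intro i hi hx
  obtain ⟨k, hk, hmax⟩ := (Finset.univ.filter (· ∉ L)).exists_max_image v ⟨i, by simpa using hi⟩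
  simp only [Finset.mem_filter, Finset.mem_univ, true_and] at hk hmax
  have hik := hmax i hi
  have hxk : x < v k := hx.trans_le hik
  have h1 := h k
  simp only [Enters, hazard_eq_bidRate_sub, not_and, not_or, not_le] at h1
  obtain ⟨h2, h3⟩ := h1 hk hmax hxk
  refine ⟨h2, (bidRate_lt_iff h2).1 ?_⟩
  have : (v k - x)⁻¹ ≤ (v i - x)⁻¹ := inv_anti₀ (by linarith) (by linarith)
  linarith

/-- A larger value than that of a bidder makes a buyer a bidder. -/
theorem IsSaturated.mem_of_inv_le (hs : IsSaturated v L x) (hx : x < v i)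
    (h : 2 ≤ L.card → (v i - x)⁻¹ ≤ bidRate v L x) : i ∈ L := by
  by_contra hi
  obtain ⟨hc, hlt⟩ := hs i hi hx
  rw [← bidRate_lt_iff hc] at hlt
  linarith [h hc]

theorem IsFeasible.value_le (hf : IsFeasible v L x) (hs : IsSaturated v L x) (hu : u ∈ L)
    (hi : i ∉ L) : v i ≤ v u := by
  by_contra! h
  have hu' := hf.lt u hu
  refine hi (hs.mem_of_inv_le (hu'.trans h) fun hc => ?_)
  have h1 := (inv_le_bidRate_iff hc).2 (hf.le u hu)
  have : (v i - x)⁻¹ ≤ (v u - x)⁻¹ := inv_anti₀ (by linarith) (by linarith)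
  linarith

/-- With at most one bidder, every buyer whose value exceeds the bid would join. -/
theorem two_le_card_of_isSaturated (hs : IsSaturated v L x) {i j : Fin n} (hij : i ≠ j)
    (hi : x < v i) (hj : x < v j) : 2 ≤ L.card := by
  by_contra hc
  have hmem : ∀ k, x < v k → k ∈ L := fun k hk => hs.mem_of_inv_le hk fun h => absurd h hc
  exact hc (Finset.one_lt_card.2 ⟨i, hmem i hi, j, hmem j hj, hij⟩)

/-- The bid rate of a feasible saturated bidding set is smallest possible, and it decreases when
values increase. -/
theorem bidRate_sum_le (hf : IsFeasible v₁ L₁ x) (hs : IsSaturated v₁ L₁ x) (h₁ : 2 ≤ L₁.card)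
    (h₂ : 2 ≤ L₂.card) (hv : ∀ i, v₂ i ≤ v₁ i) (hx : ∀ i ∈ L₂, x < v₂ i) :
    bidRate v₁ L₁ x ≤ bidRate v₂ L₂ x ∧
      ((∃ u, v₂ u < v₁ u ∧ x < v₁ u ∧ (v₁ u - x)⁻¹ < bidRate v₂ L₂ x) →
        bidRate v₁ L₁ x < bidRate v₂ L₂ x) := by
  set r := bidRate v₁ L₁ x with hr
  -- The excess `1 / (v₁ i - x) - r` is nonpositive on `L₁` and positive for other buyers with
  -- values above `x`, so `L₁` minimizes the total excess. The minimum is `-r`, and lower values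
  -- only raise the excess over `L₂`.
  have hin : ∀ i ∈ L₁, (v₁ i - x)⁻¹ - r ≤ 0 := fun i hi =>
    sub_nonpos.2 ((inv_le_bidRate_iff h₁).2 (hf.le i hi))
  have hout : ∀ i ∉ L₁, x < v₁ i → 0 < (v₁ i - x)⁻¹ - r := fun i hi hxi =>
    sub_pos.2 ((bidRate_lt_iff h₁).2 (hs i hi hxi).2)
  have hcc : ∀ i ∈ L₂, (v₁ i - x)⁻¹ ≤ (v₂ i - x)⁻¹ := fun i hi =>
    inv_anti₀ (by linarith [hx i hi]) (by linarith [hv i])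
  have e1 := sum_inv_sub_bidRate (v := v₁) (x := x) h₁
  rw [← hr] at e1
  have e2 := Finset.sum_inter_add_sum_sdiff L₁ L₂ fun i => (v₁ i - x)⁻¹ - r
  have e3 := Finset.sum_inter_add_sum_sdiff L₂ L₁ fun i => (v₁ i - x)⁻¹ - r
  rw [Finset.inter_comm] at e3
  have i1 : ∑ i ∈ L₁ \ L₂, ((v₁ i - x)⁻¹ - r) ≤ 0 :=
    Finset.sum_nonpos fun i hi => hin i (Finset.mem_sdiff.1 hi).1
  have i2 : 0 ≤ ∑ i ∈ L₂ \ L₁, ((v₁ i - x)⁻¹ - r) :=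
    Finset.sum_nonneg fun i hi => (hout i (Finset.mem_sdiff.1 hi).2
      ((hx i (Finset.mem_sdiff.1 hi).1).trans_le (hv i))).le
  have i3 : ∑ i ∈ L₂, ((v₁ i - x)⁻¹ - r) ≤ ∑ i ∈ L₂, ((v₂ i - x)⁻¹ - r) :=
    Finset.sum_le_sum fun i hi => sub_le_sub_right (hcc i hi) r
  have e4 : ∑ i ∈ L₂, ((v₂ i - x)⁻¹ - r) = ∑ i ∈ L₂, (v₂ i - x)⁻¹ - L₂.card * r := by
    rw [Finset.sum_sub_distrib, Finset.sum_const, nsmul_eq_mul]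
  refine ⟨(inv_le_bidRate_iff h₂).2 (by linarith), ?_⟩
  rintro ⟨u, huv, hxu, hu⟩
  by_contra! hle
  have hu₁ : u ∈ L₁ := hs.mem_of_inv_le hxu fun _ => (hu.trans_le hle).le
  have hlt : r < bidRate v₂ L₂ x := by
    rw [inv_lt_bidRate_iff h₂]
    -- If `u` bids in `L₂`, his lower value raises the sum strictly; if not, `L₂` lacks his strictly
    -- negative excess.
    by_cases hu₂ : u ∈ L₂
    · have : ∑ i ∈ L₂, ((v₁ i - x)⁻¹ - r) < ∑ i ∈ L₂, ((v₂ i - x)⁻¹ - r) :=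
        Finset.sum_lt_sum (fun i hi => sub_le_sub_right (hcc i hi) r)
          ⟨u, hu₂, sub_lt_sub_right (inv_strictAnti₀ (by linarith [hx u hu₂]) (by linarith)) r⟩
      linarith
    · have : ∑ i ∈ L₁ \ L₂, ((v₁ i - x)⁻¹ - r) < 0 :=
        Finset.sum_neg' (fun i hi => hin i (Finset.mem_sdiff.1 hi).1)
          ⟨u, Finset.mem_sdiff.2 ⟨hu₁, hu₂⟩, by linarith⟩
      linarith
  linarith

/-- For `v j ≥ a` the quotient `(a - z) / (v j - z)` does not decrease as `z` falls, and it
increases if `v j > a`. -/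
theorem inv_lt_bidRate_of_le_values {a : ℝ} (h : 2 ≤ L.card) (hzx : z < x) (hxa : x < a)
    (hL : ∀ j ∈ L, a ≤ v j) (ha : (a - x)⁻¹ ≤ bidRate v L x) :
    (a - z)⁻¹ < bidRate v L z := by
  have hterm : ∀ j ∈ L, (a - x) * (v j - x)⁻¹ ≤ (a - z) * (v j - z)⁻¹ := by
    intro j hj
    have hj' := hL j hj
    rw [← div_eq_mul_inv, ← div_eq_mul_inv, div_le_div_iff₀ (by linarith) (by linarith)]
    nlinarith
  have hx' : 0 < a - x := by linarith
  have hz' : 0 < a - z := by linarith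
  rw [inv_le_bidRate_iff h, ← div_eq_mul_inv, div_le_iff₀' hx', Finset.mul_sum] at ha
  rw [inv_lt_bidRate_iff h, ← div_eq_mul_inv, div_lt_iff₀' hz', Finset.mul_sum]
  by_cases hall : ∃ j ∈ L, a < v j
  · obtain ⟨j, hj, hlt⟩ := hall
    refine ha.trans_lt (Finset.sum_lt_sum hterm ⟨j, hj, ?_⟩)
    rw [← div_eq_mul_inv, ← div_eq_mul_inv, div_lt_div_iff₀ (by linarith) (by linarith)]
    nlinarith
  -- If all values equal `a`, the sum does not move, but it is `|L|`, already more than `|L| - 1`.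
  · push Not at hall
    have : ∑ j ∈ L, (a - z) * (v j - z)⁻¹ = L.card := by
      rw [Finset.sum_congr rfl (g := fun _ => (1 : ℝ))]
      · simp
      · intro j hj
        rw [le_antisymm (hall j hj) (hL j hj), mul_inv_cancel₀ hz'.ne']
    linarith

/-- Hazard rates which are nonnegative at a bid are positive below it. -/
theorem IsFeasible.inv_lt_bidRate {a : ℝ} (hf : IsFeasible v L x) (h : 2 ≤ L.card) (hzx : z < x)
    (hxa : x < a) (ha : (a - x)⁻¹ ≤ bidRate v L x) :
    (a - z)⁻¹ < bidRate v L z := by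
  -- For `a` above the smallest value `v k`, the claim follows from that for `v k`, the most
  -- demanding bidder.
  obtain ⟨k, hk, hmin⟩ := L.exists_min_image v (Finset.card_pos.1 (by omega))
  rcases le_total a (v k) with hak | hka
  · exact inv_lt_bidRate_of_le_values h hzx hxa (fun j hj => hak.trans (hmin j hj)) ha
  · have hxk := hf.lt k hk
    have h1 := inv_lt_bidRate_of_le_values h hzx hxk hmin
      ((inv_le_bidRate_iff h).2 (hf.le k hk))
    have : (a - z)⁻¹ ≤ (v k - z)⁻¹ := inv_anti₀ (by linarith) (by linarith)
    linarith

theorem IsFeasible.mono (hf : IsFeasible v L x) (h : 2 ≤ L.card) (hzx : z ≤ x) :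
    IsFeasible v L z := by
  rcases hzx.eq_or_lt with rfl | hlt
  · exact hf
  · exact ⟨fun i hi => hlt.trans (hf.lt i hi), fun i hi => (inv_le_bidRate_iff h).1
      (hf.inv_lt_bidRate h hlt (hf.lt i hi) ((inv_le_bidRate_iff h).2 (hf.le i hi))).le⟩

end

/-! ### Adding buyers greedily -/

noncomputable section

variable {n : ℕ} {v : Fin n → ℝ} {L L₀ : Finset (Fin n)} {x : ℝ} {i : Fin n}

theorem addOne_eq_self (h : ∀ i, ¬ Enters v L x i) : addOne v x L = L := by
  rw [addOne, dif_neg (by simpa using h)]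

theorem exists_addOne_eq_insert (h : ∃ i, Enters v L x i) :
    ∃ i, Enters v L x i ∧ addOne v x L = insert i L := by
  refine ⟨h.choose, h.choose_spec, ?_⟩
  rw [addOne, dif_pos h]

theorem addOne_iterate_induction {P : Finset (Fin n) → Prop} (h₀ : P L₀)
    (h : ∀ L i, P L → Enters v L x i → P (insert i L)) (k : ℕ) : P ((addOne v x)^[k] L₀) := by
  induction k with
  | zero => exact h₀
  | succ k ih =>
    rw [Function.iterate_succ_apply']
    by_cases he : ∃ i, Enters v ((addOne v x)^[k] L₀) x i
    · obtain ⟨i, hi, heq⟩ := exists_addOne_eq_insert he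
      rw [heq]
      exact h _ _ ih hi
    · rwa [addOne_eq_self (by simpa using he)]

theorem addBuyers_induction {P : Finset (Fin n) → Prop} (h₀ : P L₀)
    (h : ∀ L i, P L → Enters v L x i → P (insert i L)) : P (addBuyers v x L₀) :=
  addOne_iterate_induction h₀ h n

theorem subset_addBuyers : L₀ ⊆ addBuyers v x L₀ :=
  addBuyers_induction (P := fun L => L₀ ⊆ L) subset_rfl
    fun _ _ hL _ => hL.trans (Finset.subset_insert _ _)

theorem addBuyers_eq_self (h : ∀ i, ¬ Enters v L x i) : addBuyers v x L = L :=
  Function.iterate_fixed (addOne_eq_self h) n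

/-- If someone still enters after `k` rounds, each of these rounds added a new buyer; hence `n`
rounds exhaust all entries. -/
theorem card_addOne_iterate (k : ℕ) (h : ∃ i, Enters v ((addOne v x)^[k] L₀) x i) :
    k ≤ ((addOne v x)^[k] L₀).card := by
  induction k with
  | zero => exact Nat.zero_le _
  | succ k ih =>
    rw [Function.iterate_succ_apply'] at h ⊢
    by_cases he : ∃ i, Enters v ((addOne v x)^[k] L₀) x i
    · obtain ⟨i, hi, heq⟩ := exists_addOne_eq_insert he
      rw [heq, Finset.card_insert_of_notMem hi.1]
      exact Nat.succ_le_succ (ih he)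
    · rw [addOne_eq_self (by simpa using he)] at h
      exact absurd h he

theorem not_enters_addBuyers (i : Fin n) : ¬ Enters v (addBuyers v x L₀) x i := by
  intro hi
  have h := card_addOne_iterate n ⟨i, hi⟩
  have h' := Finset.card_lt_univ_of_notMem hi.1
  rw [Fintype.card_fin] at h'
  exact absurd h' (not_lt.2 h)

theorem isSaturated_addBuyers : IsSaturated v (addBuyers v x L₀) x :=
  isSaturated_of_not_enters not_enters_addBuyers

theorem card_lt_card_addBuyers (h : Enters v L x i) : L.card < (addBuyers v x L).card := by
  refine Finset.card_lt_card (subset_addBuyers.ssubset_of_ne fun he => ?_)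
  have := not_enters_addBuyers (v := v) (x := x) (L₀ := L) i
  rw [← he] at this
  exact this h

theorem addBuyers_spec (h₀ : ∀ j ∈ L₀, x < v j) :
    (∀ j ∈ addBuyers v x L₀, x < v j) ∧ ∀ i ∈ addBuyers v x L₀, i ∉ L₀ →
      (((addBuyers v x L₀).card : ℝ) - 1) * (v i - x)⁻¹ ≤
        ∑ j ∈ addBuyers v x L₀, (v j - x)⁻¹ := by
  -- The induction also needs that entrants come in order of decreasing value: a later entrant then
  -- has at least the weight of an earlier one and cannot spoil his inequality. `L₀` need not be
  -- feasible.
  suffices h : (∀ j ∈ addBuyers v x L₀, x < v j) ∧ ∀ i ∈ addBuyers v x L₀, i ∉ L₀ →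
      (((addBuyers v x L₀).card : ℝ) - 1) * (v i - x)⁻¹ ≤
        ∑ j ∈ addBuyers v x L₀, (v j - x)⁻¹ ∧ ∀ k ∉ addBuyers v x L₀, v k ≤ v i from
    ⟨h.1, fun i hi hi₀ => (h.2 i hi hi₀).1⟩
  refine addBuyers_induction (P := fun L => (∀ j ∈ L, x < v j) ∧ ∀ i ∈ L, i ∉ L₀ →
    ((L.card : ℝ) - 1) * (v i - x)⁻¹ ≤ ∑ j ∈ L, (v j - x)⁻¹ ∧ ∀ k ∉ L, v k ≤ v i)
    ⟨h₀, fun i hi hi' => absurd hi hi'⟩ ?_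
  rintro L e ⟨hL, hadd⟩ ⟨heL, hemax, hxe, hent⟩
  refine ⟨fun j hj => ?_, fun i hi hi₀ => ⟨?_, fun k hk => ?_⟩⟩
  · rcases Finset.mem_insert.1 hj with rfl | hj
    exacts [hxe, hL j hj]
  · rw [Finset.sum_insert heL, Finset.card_insert_of_notMem heL, Nat.cast_succ,
      add_sub_cancel_right]
    rcases Finset.mem_insert.1 hi with rfl | hi
    · have hpos : 0 ≤ (v i - x)⁻¹ := inv_nonneg.2 (by linarith)
      by_cases hc : L.card ≤ 1
      · have h1 : (L.card : ℝ) ≤ 1 := by exact_mod_cast hc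
        have h2 : 0 ≤ ∑ j ∈ L, (v j - x)⁻¹ :=
          Finset.sum_nonneg fun j hj => inv_nonneg.2 (by linarith [hL j hj])
        nlinarith
      · have h1 := hent.resolve_left hc
        rw [hazard_eq_bidRate_sub, sub_nonneg, inv_le_bidRate_iff (by omega)] at h1
        linarith
    · obtain ⟨h1, h2⟩ := hadd i hi hi₀
      have : (v i - x)⁻¹ ≤ (v e - x)⁻¹ := inv_anti₀ (by linarith) (by linarith [h2 e heL])
      linarith
  · rw [Finset.mem_insert, not_or] at hk
    rcases Finset.mem_insert.1 hi with rfl | hi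
    · exact hemax k hk.2
    · exact (hadd i hi hi₀).2 k hk.2

end

/-! ### Running down between changes; valid states and the next bid -/

noncomputable section

section Primitive

variable {n : ℕ} {v : Fin n → ℝ} {L : Finset (Fin n)} {x : ℝ} {i : Fin n}

theorem IsFeasible.continuousOn_hazardPrimitive (hf : IsFeasible v L x) (hi : i ∈ L) :
    ContinuousOn (hazardPrimitive v L i) (Set.Iic x) := fun z hz =>
  (hasDerivAt_hazardPrimitive v L i z (lt_of_le_of_lt hz (hf.lt i hi))
    fun j hj => lt_of_le_of_lt hz (hf.lt j hj)).continuousAt.continuousWithinAt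

theorem IsFeasible.strictMonoOn_hazardPrimitive (hf : IsFeasible v L x) (hc : 2 ≤ L.card)
    (hi : i ∈ L) : StrictMonoOn (hazardPrimitive v L i) (Set.Iic x) := by
  refine strictMonoOn_of_deriv_pos (convex_Iic x) (hf.continuousOn_hazardPrimitive hi) ?_
  intro z hz
  rw [interior_Iic, Set.mem_Iio] at hz
  rw [(hasDerivAt_hazardPrimitive v L i z (hz.trans (hf.lt i hi))
    fun j hj => hz.trans (hf.lt j hj)).deriv, hazard_eq_bidRate_sub, sub_pos]
  exact hf.inv_lt_bidRate hc hz (hf.lt i hi) ((inv_le_bidRate_iff hc).2 (hf.le i hi))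

/-- The bids at which a given waiting buyer wants to join form a closed set. -/
theorem IsFeasible.isClosed_setOf_enters (hf : IsFeasible v L x) (hc : 2 ≤ L.card)
    (i : Fin n) : IsClosed {y ∈ Set.Icc 0 x | Enters v L y i} := by
  by_cases h : i ∉ L ∧ ∀ j, j ∉ L → v j ≤ v i
  swap
  · convert isClosed_empty using 1
    refine Set.eq_empty_of_forall_notMem fun y hy => h ⟨hy.2.1, hy.2.2.1⟩
  have hne : ∀ y ≤ x, ∀ j ∈ L, v j - y ≠ 0 := fun y hy j hj => by linarith [hf.lt j hj]
  -- Multiplying by `v i - y` gives a condition continuous up to `y = v i`. There the sum is `0 <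
  -- |L| - 1`, so the strict inequality `y < v i` may be relaxed.
  have hset : {y ∈ Set.Icc 0 x | Enters v L y i} = Set.Icc 0 (min x (v i)) ∩
      (fun y => ∑ j ∈ L, (v i - y) * (v j - y)⁻¹) ⁻¹' Set.Ici ((L.card : ℝ) - 1) := by
    ext y
    simp only [Enters, h.1, not_false_eq_true, true_and, Set.mem_ofPred_eq, Set.mem_Icc,
      Set.mem_inter_iff, Set.mem_preimage, Set.mem_Ici, le_min_iff, hazard_eq_bidRate_sub,
      sub_nonneg, inv_le_bidRate_iff hc, ← Finset.mul_sum]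
    constructor
    · rintro ⟨⟨h0, hyx⟩, -, hyi, h1⟩
      refine ⟨⟨h0, hyx, hyi.le⟩, ?_⟩
      have h2 := h1.resolve_left (by omega)
      rwa [← div_eq_mul_inv, div_le_iff₀' (by linarith)] at h2
    · rintro ⟨⟨h0, hyx, hyi⟩, h1⟩
      have hpos := cast_card_sub_one_pos hc
      have hlt : y < v i := by
        refine hyi.lt_of_ne fun he => ?_
        rw [he, sub_self, zero_mul] at h1
        linarith
      refine ⟨⟨h0, hyx⟩, h.2, hlt, Or.inr ?_⟩
      rwa [← div_eq_mul_inv, div_le_iff₀' (by linarith)]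
  rw [hset]
  refine ContinuousOn.preimage_isClosed_of_isClosed ?_ isClosed_Icc isClosed_Ici
  refine continuousOn_finsetSum _ fun j hj => ContinuousOn.mul (by fun_prop) ?_
  exact ContinuousOn.inv₀ (by fun_prop) fun y hy => hne y (hy.2.trans (min_le_left _ _)) j hj

end Primitive

namespace Auction

variable {n : ℕ} (A : Auction n)

theorem cdf_zero (i : Fin n) : A.cdf i 0 = 0 := by simp [cdf]

theorem cdf_d (i : Fin n) : A.cdf i (A.d i) = 1 := A.prob_sum i

theorem cdf_lt_cdf {i : Fin n} {k l : ℕ} (hkl : k < l) (hl : l ≤ A.d i) :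
    A.cdf i k < A.cdf i l := by
  refine Finset.sum_lt_sum_of_subset (i := l) (Finset.Icc_subset_Icc_right hkl.le)
    (Finset.mem_Icc.2 ⟨by omega, le_rfl⟩) (fun h => ?_) (A.prob_pos i l (by omega) hl) ?_
  · exact absurd (Finset.mem_Icc.1 h).2 (by omega)
  · intro j hj _
    rw [Finset.mem_Icc] at hj
    exact (A.prob_pos i j hj.1 (hj.2.trans hl)).le

theorem cdf_le_cdf {i : Fin n} {k l : ℕ} (hkl : k ≤ l) (hl : l ≤ A.d i) :
    A.cdf i k ≤ A.cdf i l := by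
  rcases hkl.eq_or_lt with rfl | h
  exacts [le_rfl, (A.cdf_lt_cdf h hl).le]

theorem cdf_nonneg {i : Fin n} {k : ℕ} (hk : k ≤ A.d i) : 0 ≤ A.cdf i k := by
  rw [← A.cdf_zero i]
  exact A.cdf_le_cdf (Nat.zero_le _) hk

theorem value_lt_value {i : Fin n} {k l : ℕ} (hk : 1 ≤ k) (hkl : k < l) (hl : l ≤ A.d i) :
    A.value i k < A.value i l := by
  induction l, hkl using Nat.le_induction with
  | base => exact A.value_lt i k hk hl
  | succ m hm ih => exact (ih (by omega)).trans (A.value_lt i m (by omega) hl)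

theorem value_le_value {i : Fin n} {k l : ℕ} (hk : 1 ≤ k) (hkl : k ≤ l) (hl : l ≤ A.d i) :
    A.value i k ≤ A.value i l := by
  rcases hkl.eq_or_lt with rfl | h
  exacts [le_rfl, (A.value_lt_value hk h hl).le]

/-- The properties of the states that occur in the algorithm. -/
structure IsValid (s : ShootState n) : Prop where
  bid_nonneg : 0 ≤ s.bid
  one_le_level : ∀ i, 1 ≤ s.level i
  level_le : ∀ i, s.level i ≤ A.d i
  cdf_lt_F : ∀ i, A.cdf i (s.level i - 1) < s.F i
  F_le_cdf : ∀ i, s.F i ≤ A.cdf i (s.level i)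
  feasible : IsFeasible (A.cur s) s.bidders s.bid
  saturated : IsSaturated (A.cur s) s.bidders s.bid

theorem isValid_start {g : ℝ} (hg : 0 ≤ g) : A.IsValid (A.start g) where
  bid_nonneg := hg
  one_le_level := A.one_le_d
  level_le _ := le_rfl
  cdf_lt_F i := by
    have := A.one_le_d i
    rw [show (A.start g).F i = A.cdf i (A.d i) from (A.cdf_d i).symm]
    exact A.cdf_lt_cdf (show A.d i - 1 < A.d i by omega) le_rfl
  F_le_cdf i := (A.cdf_d i).ge
  feasible :=
    have h := addBuyers_spec (v := fun i => A.value i (A.d i)) (x := g) (L₀ := ∅) (by simp)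
    ⟨h.1, fun i hi => h.2 i hi (by simp)⟩
  saturated := isSaturated_addBuyers

variable {A} {s : ShootState n} {y z : ℝ} {i : Fin n}

theorem IsValid.F_pos (hs : A.IsValid s) (i : Fin n) : 0 < s.F i :=
  (A.cdf_nonneg ((Nat.sub_le _ _).trans (hs.level_le i))).trans_lt (hs.cdf_lt_F i)

theorem extendF_of_notMem (hi : i ∉ s.bidders) : A.extendF s y i = s.F i := if_neg hi

theorem extendF_bid (s : ShootState n) (i : Fin n) : A.extendF s s.bid i = s.F i := by
  simp [extendF]

theorem IsValid.extendF_pos (hs : A.IsValid s) (y : ℝ) (i : Fin n) : 0 < A.extendF s y i := by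
  have := hs.F_pos i
  unfold extendF
  split_ifs <;> positivity

theorem IsValid.strictMonoOn_extendF (hs : A.IsValid s) (hc : 2 ≤ s.bidders.card)
    (hi : i ∈ s.bidders) : StrictMonoOn (fun y => A.extendF s y i) (Set.Iic s.bid) := by
  intro a ha b hb hab
  have h := hs.feasible.strictMonoOn_hazardPrimitive hc hi ha hb hab
  simp only [extendF, if_pos hi]
  exact mul_lt_mul_of_pos_left (Real.exp_lt_exp.2 (by linarith)) (hs.F_pos i)

theorem IsValid.extendF_lt (hs : A.IsValid s) (hc : 2 ≤ s.bidders.card) (hi : i ∈ s.bidders)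
    (hy : y < s.bid) : A.extendF s y i < s.F i := by
  rw [← A.extendF_bid s i]
  exact hs.strictMonoOn_extendF hc hi (Set.mem_Iic.2 hy.le) (Set.mem_Iic.2 le_rfl) hy

theorem IsValid.extendF_le (hs : A.IsValid s) (hc : 2 ≤ s.bidders.card)
    (hy : y < s.bid) (i : Fin n) : A.extendF s y i ≤ s.F i := by
  by_cases hi : i ∈ s.bidders
  · exact (hs.extendF_lt hc hi hy).le
  · exact (extendF_of_notMem hi).le

theorem IsValid.continuousOn_extendF (hs : A.IsValid s) (hi : i ∈ s.bidders) :
    ContinuousOn (fun y => A.extendF s y i) (Set.Iic s.bid) := by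
  simp only [extendF, if_pos hi]
  exact continuousOn_const.mul
    ((hs.feasible.continuousOn_hazardPrimitive hi).sub continuousOn_const).rexp

theorem IsValid.not_changesAt_bid (hs : A.IsValid s) : ¬ A.ChangesAt s s.bid := by
  rintro (⟨i, hi, he⟩ | ⟨i, hi⟩)
  · rw [extendF_bid] at he
    exact (hs.cdf_lt_F i).ne' he
  · exact hs.saturated.not_enters i hi

/-- Changes form a closed subset of `[0, bid]`, and none occurs at `bid` itself, so requiring `y <
bid` keeps the set compact and the supremum is attained. -/
theorem IsValid.isGreatest_nextBid (hs : A.IsValid s) (hr : Running s) :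
    IsGreatest {y : ℝ | 0 ≤ y ∧ y < s.bid ∧ (y = 0 ∨ A.ChangesAt s y)} (A.nextBid s) := by
  set T := {y : ℝ | 0 ≤ y ∧ y < s.bid ∧ (y = 0 ∨ A.ChangesAt s y)} with hT
  have hclosed : IsClosed T := by
    have : T = {0} ∪ ((⋃ i, {y ∈ Set.Icc 0 s.bid | A.LeavesAt s y i}) ∪
        ⋃ i, {y ∈ Set.Icc 0 s.bid | Enters (A.cur s) s.bidders y i}) := by
      ext y
      simp only [hT, ChangesAt, Set.mem_ofPred_eq, Set.mem_union, Set.mem_singleton_iff,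
        Set.mem_iUnion, exists_and_left, ← and_or_left, Set.mem_Icc]
      constructor
      · rintro ⟨h0, h1, h2⟩
        exact h2.imp id fun h => ⟨⟨h0, h1.le⟩, h⟩
      · rintro (rfl | ⟨⟨h0, h1⟩, h2⟩)
        · exact ⟨le_rfl, hr.2, Or.inl rfl⟩
        · refine ⟨h0, h1.lt_of_ne ?_, Or.inr h2⟩
          rintro rfl
          exact hs.not_changesAt_bid h2
    rw [this]
    refine isClosed_singleton.union ((isClosed_iUnion_of_finite fun i => ?_).union
      (isClosed_iUnion_of_finite fun i => hs.feasible.isClosed_setOf_enters hr.1 i))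
    by_cases hi : i ∈ s.bidders
    · have : {y ∈ Set.Icc 0 s.bid | A.LeavesAt s y i} = Set.Icc 0 s.bid ∩
          (fun y => A.extendF s y i) ⁻¹' {A.cdf i (s.level i - 1)} := by
        ext y
        simp [LeavesAt, hi]
      rw [this]
      exact ((hs.continuousOn_extendF hi).mono Set.Icc_subset_Iic_self
        ).preimage_isClosed_of_isClosed isClosed_Icc isClosed_singleton
    · convert isClosed_empty using 1
      exact Set.eq_empty_of_forall_notMem fun y hy => hi hy.2.1
  have hcompact : IsCompact T :=
    isCompact_Icc.of_isClosed_subset hclosed fun y hy => ⟨hy.1, hy.2.1.le⟩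
  exact hcompact.isGreatest_sSup ⟨0, le_rfl, hr.2, Or.inl rfl⟩

theorem IsValid.nextBid_nonneg (hs : A.IsValid s) (hr : Running s) : 0 ≤ A.nextBid s :=
  (hs.isGreatest_nextBid hr).1.1

theorem IsValid.nextBid_lt (hs : A.IsValid s) (hr : Running s) : A.nextBid s < s.bid :=
  (hs.isGreatest_nextBid hr).1.2.1

theorem IsValid.not_changesAt (hs : A.IsValid s) (hr : Running s) (hz : A.nextBid s < z)
    (hz' : z < s.bid) : ¬ A.ChangesAt s z := fun h =>
  hz.not_ge ((hs.isGreatest_nextBid hr).2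
    ⟨(hs.nextBid_nonneg hr).trans hz.le, hz', Or.inr h⟩)

theorem IsValid.isSaturated (hs : A.IsValid s) (hr : Running s) (hz : A.nextBid s < z)
    (hz' : z < s.bid) : IsSaturated (A.cur s) s.bidders z :=
  isSaturated_of_not_enters fun i hi => hs.not_changesAt hr hz hz' (Or.inr ⟨i, hi⟩)

/-- To fall below the threshold, `F_i` would have to cross it earlier, and crossing is leaving. -/
theorem IsValid.cdf_le_extendF (hs : A.IsValid s) (hr : Running s) (hy : A.nextBid s ≤ y)
    (hy' : y < s.bid) (i : Fin n) : A.cdf i (s.level i - 1) ≤ A.extendF s y i := by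
  by_cases hi : i ∈ s.bidders
  · by_contra! hlt
    have hF := hs.cdf_lt_F i
    rw [← A.extendF_bid s i] at hF
    obtain ⟨z, hz, he⟩ := intermediate_value_Ioo hy'.le
      ((hs.continuousOn_extendF hi).mono Set.Icc_subset_Iic_self) ⟨hlt, hF⟩
    exact hs.not_changesAt hr (hy.trans_lt hz.1) hz.2 (Or.inl ⟨i, hi, he⟩)
  · rw [extendF_of_notMem hi]
    exact (hs.cdf_lt_F i).le

end Auction

end

/-! ### Moving to intermediate bids; termination -/

noncomputable section
namespace Auction

variable {n : ℕ} (A : Auction n)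

open Classical in
/-- The level of a buyer after the buyers who leave at the bid `y` have consumed a value. -/
def levelAt (s : ShootState n) (y : ℝ) (i : Fin n) : ℕ :=
  if A.LeavesAt s y i then s.level i - 1 else s.level i

open Classical in
/-- The buyers of the bidding set who do not leave at the bid `y`. -/
def stayersAt (s : ShootState n) (y : ℝ) : Finset (Fin n) :=
  s.bidders.filter fun i => ¬ A.LeavesAt s y i

/-- The state at a bid `y` which is not below the next change of the bidding set. -/
def moveTo (s : ShootState n) (y : ℝ) : ShootState n where
  bid := y
  bidders := addBuyers (fun i => A.value i (A.levelAt s y i)) y (A.stayersAt s y)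
  level := A.levelAt s y
  F := A.extendF s y

theorem step_eq_moveTo (s : ShootState n) : A.step s = A.moveTo s (A.nextBid s) := rfl

variable {A} {s : ShootState n} {y z : ℝ} {i j : Fin n}

theorem mem_stayersAt : i ∈ A.stayersAt s y ↔ i ∈ s.bidders ∧ ¬ A.LeavesAt s y i := by
  simp [stayersAt]

theorem stayersAt_of_not_leavesAt (h : ∀ i, ¬ A.LeavesAt s y i) :
    A.stayersAt s y = s.bidders := by
  ext i
  simp [mem_stayersAt, h]

theorem levelAt_of_leavesAt (h : A.LeavesAt s y i) : A.levelAt s y i = s.level i - 1 := if_pos h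

theorem levelAt_of_not_leavesAt (h : ¬ A.LeavesAt s y i) : A.levelAt s y i = s.level i := if_neg h

theorem levelAt_le (s : ShootState n) (y : ℝ) (i : Fin n) : A.levelAt s y i ≤ s.level i := by
  unfold levelAt
  split_ifs <;> omega

/-- Leaving with the lowest value would need `F_i = 0`, but an exponential factor keeps `F_i`
positive. -/
theorem IsValid.one_le_levelAt (hs : A.IsValid s) (y : ℝ) (i : Fin n) :
    1 ≤ A.levelAt s y i := by
  have h1 := hs.one_le_level i
  by_cases h : A.LeavesAt s y i
  · rw [levelAt_of_leavesAt h]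
    by_contra! h0
    have hpos := hs.extendF_pos y i
    rw [h.2, Nat.lt_one_iff.1 h0, cdf_zero] at hpos
    exact lt_irrefl _ hpos
  · rwa [levelAt_of_not_leavesAt h]

theorem IsValid.cur_moveTo_le (hs : A.IsValid s) (y : ℝ) (i : Fin n) :
    A.cur (A.moveTo s y) i ≤ A.cur s i :=
  A.value_le_value (hs.one_le_levelAt y i) (levelAt_le s y i) (hs.level_le i)

theorem cur_moveTo_of_not_leavesAt (h : ¬ A.LeavesAt s y i) :
    A.cur (A.moveTo s y) i = A.cur s i :=
  congrArg (A.value i) (levelAt_of_not_leavesAt h)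

theorem IsValid.lt_cur_moveTo (hs : A.IsValid s) (hy : y < s.bid) :
    ∀ i ∈ (A.moveTo s y).bidders, y < A.cur (A.moveTo s y) i := by
  refine (addBuyers_spec fun i hi => ?_).1
  rw [mem_stayersAt] at hi
  exact (hy.trans (hs.feasible.lt i hi.1)).trans_eq (cur_moveTo_of_not_leavesAt hi.2).symm

/-- The old value of every old bidder, even of one who leaves at `y`, still meets the entry
criterion against the new bidding set. For stayers this is feasibility; for leavers it makes them
witnesses of `IsAhead`. -/
theorem IsValid.card_sub_one_mul_le_moveTo (hs : A.IsValid s) (hr : Running s) (hy : y < s.bid)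
    (hj : j ∈ s.bidders) :
    (((A.moveTo s y).bidders.card : ℝ) - 1) * (A.cur s j - y)⁻¹ ≤
      ∑ i ∈ (A.moveTo s y).bidders, (A.cur (A.moveTo s y) i - y)⁻¹ := by
  have hf := hs.feasible.mono hr.1 hy.le
  refine card_sub_one_mul_le_sum (c := fun i => (A.cur s i - y)⁻¹) (L := s.bidders)
    (fun i hi => inv_nonneg.2 (sub_nonneg.2 (hf.lt i hi).le)) hf.le hj (fun i hi _ => ?_)
    fun i hi hi' => ?_
  · have := hs.lt_cur_moveTo hy i hi
    exact inv_anti₀ (by linarith) (by linarith [hs.cur_moveTo_le y i])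
  · have := hs.lt_cur_moveTo hy i hi
    refine inv_anti₀ (by linarith) ?_
    linarith [hs.cur_moveTo_le y i, hs.feasible.value_le hs.saturated hj hi']

theorem IsValid.moveTo (hs : A.IsValid s) (hr : Running s) (hy : A.nextBid s ≤ y)
    (hy' : y < s.bid) : A.IsValid (A.moveTo s y) where
  bid_nonneg := (hs.nextBid_nonneg hr).trans hy
  one_le_level := hs.one_le_levelAt y
  level_le i := (levelAt_le s y i).trans (hs.level_le i)
  cdf_lt_F i := by
    have h1 := hs.one_le_levelAt y i
    change A.cdf i (A.levelAt s y i - 1) < A.extendF s y i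
    by_cases h : A.LeavesAt s y i
    · rw [h.2, ← levelAt_of_leavesAt h]
      exact A.cdf_lt_cdf (by omega) ((levelAt_le s y i).trans (hs.level_le i))
    · rw [levelAt_of_not_leavesAt h]
      by_cases hi : i ∈ s.bidders
      · exact (hs.cdf_le_extendF hr hy hy' i).lt_of_ne fun he => h ⟨hi, he.symm⟩
      · rw [extendF_of_notMem hi]
        exact hs.cdf_lt_F i
  F_le_cdf i := by
    change A.extendF s y i ≤ A.cdf i (A.levelAt s y i)
    by_cases h : A.LeavesAt s y i
    · rw [h.2, levelAt_of_leavesAt h]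
    · rw [levelAt_of_not_leavesAt h]
      exact (hs.extendF_le hr.1 hy' i).trans (hs.F_le_cdf i)
  feasible := by
    refine ⟨hs.lt_cur_moveTo hy', fun i hi => ?_⟩
    by_cases h : i ∈ s.bidders ∧ ¬ A.LeavesAt s y i
    · have := hs.card_sub_one_mul_le_moveTo hr hy' h.1
      rwa [← cur_moveTo_of_not_leavesAt h.2] at this
    · refine (addBuyers_spec fun k hk => ?_).2 i hi (by rwa [mem_stayersAt])
      rw [mem_stayersAt] at hk
      exact (hy'.trans (hs.feasible.lt k hk.1)).trans_eq (cur_moveTo_of_not_leavesAt hk.2).symm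
  saturated := isSaturated_addBuyers

theorem IsValid.step (hs : A.IsValid s) (hr : Running s) : A.IsValid (A.step s) :=
  hs.moveTo hr le_rfl (hs.nextBid_lt hr)

theorem moveTo_of_not_changesAt (h : ¬ A.ChangesAt s y) : A.moveTo s y =
    { bid := y, bidders := s.bidders, level := s.level, F := A.extendF s y } := by
  simp only [ChangesAt, not_or, not_exists] at h
  have hl : A.levelAt s y = s.level := funext fun i => levelAt_of_not_leavesAt (h.1 i)
  unfold moveTo
  rw [hl, stayersAt_of_not_leavesAt h.1]
  exact congrArg (ShootState.mk y · _ _) (addBuyers_eq_self h.2)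

/-- An interruption strictly before the next change is harmless because the exponents in `extendF`
add up. This permits comparing two runs at common bids although they change at different ones. -/
theorem IsValid.step_moveTo (hs : A.IsValid s) (hr : Running s) (hy : A.nextBid s < y)
    (hy' : y < s.bid) : A.step (A.moveTo s y) = A.step s := by
  rw [moveTo_of_not_changesAt (hs.not_changesAt hr hy hy')]
  set t : ShootState n := ⟨y, s.bidders, s.level, A.extendF s y⟩ with ht
  have hF : ∀ z, A.extendF t z = A.extendF s z := by
    intro z
    funext i
    have hcur : A.cur t = A.cur s := rfl
    by_cases hi : i ∈ s.bidders
    · have hi' : i ∈ t.bidders := hi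
      simp only [extendF, if_pos hi, if_pos hi', hcur]
      simp only [ht, extendF, if_pos hi]
      rw [mul_assoc, ← Real.exp_add]
      ring_nf
    · have hi' : i ∉ t.bidders := hi
      rw [extendF_of_notMem hi, extendF_of_notMem hi']
      exact extendF_of_notMem hi
  have hlv : ∀ z i, A.LeavesAt t z i ↔ A.LeavesAt s z i := fun z i => by
    simp only [LeavesAt, hF]
    rfl
  have hch : ∀ z, A.ChangesAt t z ↔ A.ChangesAt s z := fun z => by
    simp only [ChangesAt, hlv]
    rfl
  have hg := hs.isGreatest_nextBid hr
  have hnext : A.nextBid t = A.nextBid s := by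
    refine IsGreatest.csSup_eq ⟨⟨hg.1.1, hy, ?_⟩, fun z hz => ?_⟩
    · simpa only [hch] using hg.1.2.2
    · exact hg.2 ⟨hz.1, hz.2.1.trans hy', by simpa only [hch] using hz.2.2⟩
  have hlevel : ∀ z, A.levelAt t z = A.levelAt s z := fun z => by
    funext i
    by_cases h : A.LeavesAt s z i
    · rw [levelAt_of_leavesAt h, levelAt_of_leavesAt ((hlv z i).2 h)]
    · rw [levelAt_of_not_leavesAt h, levelAt_of_not_leavesAt (mt (hlv z i).1 h)]
  have hstay : ∀ z, A.stayersAt t z = A.stayersAt s z := fun z => by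
    ext i
    simp only [mem_stayersAt, hlv]
    rfl
  simp only [step_eq_moveTo, hnext]
  unfold Auction.moveTo
  rw [hlevel, hstay, hF]

/-- The number of changes of the bidding set which are still possible is at most this. -/
def potential (s : ShootState n) : ℕ := (n + 1) * ∑ i, s.level i + (n - s.bidders.card)

theorem card_le (L : Finset (Fin n)) : L.card ≤ n := by
  simpa using L.card_le_univ

/-- A departure lowers the first term by at least `n + 1`, more than the waiting list can grow;
without departures an entry shortens the waiting list. -/
theorem IsValid.potential_moveTo_lt (hs : A.IsValid s) (h : A.ChangesAt s y) :
    potential (A.moveTo s y) < potential s := by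
  have hle : ∀ i, (A.moveTo s y).level i ≤ s.level i := levelAt_le s y
  have hcard := card_le s.bidders
  have hcard' := card_le (A.moveTo s y).bidders
  unfold potential
  by_cases hl : ∃ i, A.LeavesAt s y i
  · obtain ⟨i, hi⟩ := hl
    have hlt : ∑ i, (A.moveTo s y).level i < ∑ i, s.level i := by
      refine Finset.sum_lt_sum (fun i _ => hle i) ⟨i, Finset.mem_univ i, ?_⟩
      change A.levelAt s y i < _
      rw [levelAt_of_leavesAt hi]
      have := hs.one_le_level i
      omega
    have := Nat.mul_le_mul_left (n + 1) (Nat.succ_le_of_lt hlt)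
    rw [Nat.succ_eq_add_one, mul_add, mul_one] at this
    omega
  · obtain ⟨i, hi⟩ := h.resolve_left hl
    push Not at hl
    have hsum := Nat.mul_le_mul_left (n + 1) (Finset.sum_le_sum fun i (_ : i ∈ Finset.univ) => hle i)
    have hlt : s.bidders.card < (A.moveTo s y).bidders.card := by
      have hlev : A.levelAt s y = s.level := funext fun i => levelAt_of_not_leavesAt (hl i)
      have h1 := card_lt_card_addBuyers hi
      unfold Auction.moveTo
      rw [hlev, stayersAt_of_not_leavesAt hl]
      exact h1
    omega

theorem IsValid.potential_moveTo_le (hs : A.IsValid s) (y : ℝ) :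
    potential (A.moveTo s y) ≤ potential s := by
  by_cases h : A.ChangesAt s y
  · exact (hs.potential_moveTo_lt h).le
  · rw [moveTo_of_not_changesAt h]
    rfl

theorem IsValid.potential_moveTo_nextBid_lt (hs : A.IsValid s) (hr : Running s)
    (h : 0 < A.nextBid s) : potential (A.moveTo s (A.nextBid s)) < potential s :=
  hs.potential_moveTo_lt ((hs.isGreatest_nextBid hr).1.2.2.resolve_left h.ne')

theorem IsValid.halts (hs : A.IsValid s) : ∃ N : ℕ, ¬ Running (A.step^[N] s) := by
  induction hp : potential s using Nat.strong_induction_on generalizing s with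
  | _ p ih =>
    by_cases hr : Running s
    swap
    · exact ⟨0, hr⟩
    by_cases hpos : 0 < A.nextBid s
    · obtain ⟨N, hN⟩ := ih _ (hp ▸ hs.potential_moveTo_nextBid_lt hr hpos) (hs.step hr) rfl
      exact ⟨N + 1, hN⟩
    · exact ⟨1, fun h => hpos h.2⟩

variable (A) in
/-- The state in which the loop is left when it is entered in the state `s`. -/
def endState (s : ShootState n) : ShootState n :=
  A.step^[sInf {N : ℕ | ¬ Running (A.step^[N] s)}] s

theorem endState_of_not_running (hr : ¬ Running s) : A.endState s = s := by
  have : sInf {N : ℕ | ¬ Running (A.step^[N] s)} = 0 := Nat.sInf_eq_zero.2 (Or.inl hr)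
  rw [endState, this, Function.iterate_zero_apply]

theorem IsValid.endState_step (hs : A.IsValid s) (hr : Running s) :
    A.endState (A.step s) = A.endState s := by
  have hmem := Nat.sInf_mem (s := {N : ℕ | ¬ Running (A.step^[N] (A.step s))}) (hs.step hr).halts
  have hl : IsLeast {N : ℕ | ¬ Running (A.step^[N] s)}
      (sInf {N : ℕ | ¬ Running (A.step^[N] (A.step s))} + 1) := by
    refine ⟨hmem, fun N hN => ?_⟩
    cases N with
    | zero => exact absurd hr hN
    | succ N => exact Nat.succ_le_succ (Nat.sInf_le hN)
  rw [endState, endState, hl.csInf_eq, Function.iterate_succ_apply]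

theorem IsValid.endState_moveTo (hs : A.IsValid s) (hr : Running s) (hy : A.nextBid s ≤ y)
    (hy' : y < s.bid) : A.endState (A.moveTo s y) = A.endState s := by
  rcases hy.eq_or_lt with rfl | hlt
  · exact hs.endState_step hr
  · have hr' : Running (A.moveTo s y) := by
      refine ⟨?_, (hs.nextBid_nonneg hr).trans_lt hlt⟩
      rw [moveTo_of_not_changesAt (hs.not_changesAt hr hlt hy')]
      exact hr.1
    rw [← (hs.moveTo hr hy hy').endState_step hr', hs.step_moveTo hr hlt hy',
      hs.endState_step hr]

theorem IsValid.not_running_endState (hs : A.IsValid s) : ¬ Running (A.endState s) :=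
  Nat.sInf_mem (s := {N : ℕ | ¬ Running (A.step^[N] s)}) hs.halts

theorem IsValid.endState_spec (hs : A.IsValid s) :
    A.IsValid (A.endState s) ∧ (A.endState s).bid ≤ s.bid := by
  suffices h : ∀ N, (∀ k < N, Running (A.step^[k] s)) →
      A.IsValid (A.step^[N] s) ∧ (A.step^[N] s).bid ≤ s.bid from
    h _ fun k hk => not_not.1 (Nat.notMem_of_lt_sInf hk)
  intro N
  induction N with
  | zero => exact fun _ => ⟨hs, le_rfl⟩
  | succ N ih =>
    intro h
    obtain ⟨h1, h2⟩ := ih fun k hk => h k (hk.trans N.lt_succ_self)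
    have hr := h N N.lt_succ_self
    rw [Function.iterate_succ_apply']
    exact ⟨h1.step hr, (h1.nextBid_lt hr).le.trans h2⟩

theorem IsValid.endState_bid_lt (hs : A.IsValid s) (hr : Running s) :
    (A.endState s).bid < s.bid := by
  rw [← hs.endState_step hr]
  exact (hs.step hr).endState_spec.2.trans_lt (hs.nextBid_lt hr)

end Auction

end

/-! ### Comparing two states at a common bid -/

noncomputable section

section Primitive

variable {n : ℕ} {v₁ v₂ : Fin n → ℝ} {L₁ L₂ : Finset (Fin n)} {x y : ℝ} {i : Fin n}

/-- For a buyer with equal values in both states the terms `1 / (v_i - z)` cancel, leaving only the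
bid rates to compare. -/
theorem hasDerivAt_hazardPrimitive_sub (hf₁ : IsFeasible v₁ L₁ x) (hf₂ : IsFeasible v₂ L₂ x)
    (hi₁ : i ∈ L₁) (hi₂ : i ∈ L₂) (hv : v₂ i = v₁ i) {z : ℝ} (hz : z ≤ x) :
    HasDerivAt (fun z => hazardPrimitive v₁ L₁ i z - hazardPrimitive v₂ L₂ i z)
      (bidRate v₁ L₁ z - bidRate v₂ L₂ z) z := by
  have h := (hasDerivAt_hazardPrimitive v₁ L₁ i z (hz.trans_lt (hf₁.lt i hi₁))
    fun j hj => hz.trans_lt (hf₁.lt j hj)).sub (hasDerivAt_hazardPrimitive v₂ L₂ i z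
      (hz.trans_lt (hf₂.lt i hi₂)) fun j hj => hz.trans_lt (hf₂.lt j hj))
  rw [hazard_eq_bidRate_sub, hazard_eq_bidRate_sub, hv, sub_sub_sub_cancel_right] at h
  exact h

theorem continuousOn_hazardPrimitive_sub (hf₁ : IsFeasible v₁ L₁ x) (hf₂ : IsFeasible v₂ L₂ x)
    (hi₁ : i ∈ L₁) (hi₂ : i ∈ L₂) (hv : v₂ i = v₁ i) :
    ContinuousOn (fun z => hazardPrimitive v₁ L₁ i z - hazardPrimitive v₂ L₂ i z)
      (Set.Icc y x) := fun _ hz =>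
  (hasDerivAt_hazardPrimitive_sub hf₁ hf₂ hi₁ hi₂ hv hz.2).continuousAt.continuousWithinAt

theorem hazardPrimitive_sub_le (hf₁ : IsFeasible v₁ L₁ x) (hf₂ : IsFeasible v₂ L₂ x)
    (hi₁ : i ∈ L₁) (hi₂ : i ∈ L₂) (hv : v₂ i = v₁ i) (hyx : y < x)
    (h : ∀ z, y < z → z < x → bidRate v₁ L₁ z ≤ bidRate v₂ L₂ z) :
    hazardPrimitive v₂ L₂ i y - hazardPrimitive v₂ L₂ i x ≤
      hazardPrimitive v₁ L₁ i y - hazardPrimitive v₁ L₁ i x := by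
  have hanti := antitoneOn_of_hasDerivWithinAt_nonpos (convex_Icc y x)
    (continuousOn_hazardPrimitive_sub hf₁ hf₂ hi₁ hi₂ hv)
    (fun z hz => (hasDerivAt_hazardPrimitive_sub hf₁ hf₂ hi₁ hi₂ hv
      (interior_subset hz).2).hasDerivWithinAt) fun z hz => by
        rw [interior_Icc] at hz
        exact sub_nonpos.2 (h z hz.1 hz.2)
  have := hanti (Set.left_mem_Icc.2 hyx.le) (Set.right_mem_Icc.2 hyx.le) hyx.le
  simp only at this
  linarith

theorem hazardPrimitive_sub_lt (hf₁ : IsFeasible v₁ L₁ x) (hf₂ : IsFeasible v₂ L₂ x)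
    (hi₁ : i ∈ L₁) (hi₂ : i ∈ L₂) (hv : v₂ i = v₁ i) (hyx : y < x)
    (h : ∀ z, y < z → z < x → bidRate v₁ L₁ z < bidRate v₂ L₂ z) :
    hazardPrimitive v₂ L₂ i y - hazardPrimitive v₂ L₂ i x <
      hazardPrimitive v₁ L₁ i y - hazardPrimitive v₁ L₁ i x := by
  have hanti := strictAntiOn_of_hasDerivWithinAt_neg (convex_Icc y x)
    (continuousOn_hazardPrimitive_sub hf₁ hf₂ hi₁ hi₂ hv)
    (fun z hz => (hasDerivAt_hazardPrimitive_sub hf₁ hf₂ hi₁ hi₂ hv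
      (interior_subset hz).2).hasDerivWithinAt) fun z hz => by
        rw [interior_Icc] at hz
        exact sub_neg.2 (h z hz.1 hz.2)
  have := hanti (Set.left_mem_Icc.2 hyx.le) (Set.right_mem_Icc.2 hyx.le) hyx
  simp only at this
  linarith

end Primitive

namespace Auction

variable {n : ℕ} {A : Auction n} {s s₁ s₂ : ShootState n} {y z : ℝ} {i j u : Fin n}

/-- `F_i` lies in `(G_i(v_i^{k-1}), G_i(v_i^k)]`, which determines `k` as a monotone function of
`F_i`. -/
theorem IsValid.level_le_level (h₁ : A.IsValid s₁) (h₂ : A.IsValid s₂) (hF : s₂.F i ≤ s₁.F i) :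
    s₂.level i ≤ s₁.level i := by
  by_contra! h
  have h1 := h₁.F_le_cdf i
  have h2 := h₂.cdf_lt_F i
  have := A.cdf_le_cdf (i := i) (show s₁.level i ≤ s₂.level i - 1 by omega)
    ((Nat.sub_le _ _).trans (h₂.level_le i))
  linarith

theorem IsValid.cur_le_cur (h₁ : A.IsValid s₁) (h₂ : A.IsValid s₂)
    (h : s₂.level i ≤ s₁.level i) : A.cur s₂ i ≤ A.cur s₁ i :=
  A.value_le_value (h₂.one_le_level i) h (h₁.level_le i)

/-- At a common bid, the bid distribution functions of the state `s₂` lie below those of `s₁`. -/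
structure IsBelow (s₂ s₁ : ShootState n) : Prop where
  bid_eq : s₂.bid = s₁.bid
  F_le : ∀ i, s₂.F i ≤ s₁.F i

variable (A) in
/-- Buyer `u` has a larger value in the state `s₁` than in `s₂`, which is so large that it makes the
bid rate in `s₁` smaller than in `s₂` just below the common bid. -/
def IsAhead (s₂ s₁ : ShootState n) (u : Fin n) : Prop :=
  s₂.level u < s₁.level u ∧ s₂.bid < A.cur s₁ u ∧
    (A.cur s₁ u - s₂.bid)⁻¹ ≤ bidRate (A.cur s₂) s₂.bidders s₂.bid

theorem IsBelow.bidRate_le (hb : IsBelow s₂ s₁) (h₁ : A.IsValid s₁) (h₂ : A.IsValid s₂)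
    (hr₁ : Running s₁) (hr₂ : Running s₂) (hz₁ : A.nextBid s₁ < z) (hz : z < s₁.bid) :
    bidRate (A.cur s₁) s₁.bidders z ≤ bidRate (A.cur s₂) s₂.bidders z ∧
      ((∃ u, A.IsAhead s₂ s₁ u) →
        bidRate (A.cur s₁) s₁.bidders z < bidRate (A.cur s₂) s₂.bidders z) := by
  have hz' : z < s₂.bid := hz.trans_eq hb.bid_eq.symm
  have h := bidRate_sum_le (h₁.feasible.mono hr₁.1 hz.le) (h₁.isSaturated hr₁ hz₁ hz) hr₁.1 hr₂.1
    (fun i => h₁.cur_le_cur h₂ (h₁.level_le_level h₂ (hb.F_le i)))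
    fun i hi => hz'.trans (h₂.feasible.lt i hi)
  refine ⟨h.1, ?_⟩
  rintro ⟨u, hu, hu', hrate⟩
  have hzu := hz'.trans hu'
  exact h.2 ⟨u, A.value_lt_value (h₂.one_le_level u) hu (h₁.level_le u), hzu,
    h₂.feasible.inv_lt_bidRate hr₂.1 hz' hu' hrate⟩

/-- The rate in `s₂` is at least that in `s₁`, so the same value passes the entry test there too. -/
theorem IsBelow.mem_bidders (hb : IsBelow s₂ s₁) (h₁ : A.IsValid s₁) (h₂ : A.IsValid s₂)
    (hr₁ : Running s₁) (hr₂ : Running s₂) (hl : s₂.level i = s₁.level i) (hi : i ∈ s₁.bidders) :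
    i ∈ s₂.bidders := by
  have hcur : A.cur s₂ i = A.cur s₁ i := congrArg (A.value i) hl
  have hx := h₁.feasible.lt i hi
  refine h₂.saturated.mem_of_inv_le (by rwa [hcur, hb.bid_eq]) fun _ => ?_
  have h1 := (inv_le_bidRate_iff hr₁.1).2 (h₁.feasible.le i hi)
  rw [hcur, hb.bid_eq]
  refine h1.trans (bidRate_sum_le h₁.feasible h₁.saturated hr₁.1 hr₂.1
    (fun i => h₁.cur_le_cur h₂ (h₁.level_le_level h₂ (hb.F_le i))) fun i hi => ?_).1
  rw [← hb.bid_eq]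
  exact h₂.feasible.lt i hi

theorem extendF_mul_le_of_hazardPrimitive_sub_le (h₁ : A.IsValid s₁) (h₂ : A.IsValid s₂) (hi₁ : i ∈ s₁.bidders)
    (hi₂ : i ∈ s₂.bidders) (hbid : s₂.bid = s₁.bid)
    (h : hazardPrimitive (A.cur s₂) s₂.bidders i y - hazardPrimitive (A.cur s₂) s₂.bidders i s₁.bid
      ≤ hazardPrimitive (A.cur s₁) s₁.bidders i y -
        hazardPrimitive (A.cur s₁) s₁.bidders i s₁.bid) :
    A.extendF s₂ y i * s₁.F i ≤ A.extendF s₁ y i * s₂.F i := by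
  simp only [extendF, if_pos hi₁, if_pos hi₂, hbid]
  have := mul_le_mul_of_nonneg_left (Real.exp_le_exp.2 h)
    (mul_pos (h₂.F_pos i) (h₁.F_pos i)).le
  linarith

theorem extendF_mul_lt_of_hazardPrimitive_sub_lt (h₁ : A.IsValid s₁) (h₂ : A.IsValid s₂) (hi₁ : i ∈ s₁.bidders)
    (hi₂ : i ∈ s₂.bidders) (hbid : s₂.bid = s₁.bid)
    (h : hazardPrimitive (A.cur s₂) s₂.bidders i y - hazardPrimitive (A.cur s₂) s₂.bidders i s₁.bid
      < hazardPrimitive (A.cur s₁) s₁.bidders i y -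
        hazardPrimitive (A.cur s₁) s₁.bidders i s₁.bid) :
    A.extendF s₂ y i * s₁.F i < A.extendF s₁ y i * s₂.F i := by
  simp only [extendF, if_pos hi₁, if_pos hi₂, hbid]
  have := mul_lt_mul_of_pos_left (Real.exp_lt_exp.2 h) (mul_pos (h₂.F_pos i) (h₁.F_pos i))
  linarith

/-- The ratio of the two distribution functions of a buyer with the same value in both states does
not decrease when the bids run down. -/
theorem IsBelow.extendF_mul_le (hb : IsBelow s₂ s₁) (h₁ : A.IsValid s₁) (h₂ : A.IsValid s₂)
    (hr₁ : Running s₁) (hr₂ : Running s₂) (hy₁ : A.nextBid s₁ ≤ y) (hy : y < s₁.bid)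
    (hl : s₂.level i = s₁.level i) :
    A.extendF s₂ y i * s₁.F i ≤ A.extendF s₁ y i * s₂.F i := by
  by_cases hi₁ : i ∈ s₁.bidders
  · have hi₂ := hb.mem_bidders h₁ h₂ hr₁ hr₂ hl hi₁
    have hf₂ := h₂.feasible
    rw [hb.bid_eq] at hf₂
    exact extendF_mul_le_of_hazardPrimitive_sub_le h₁ h₂ hi₁ hi₂ hb.bid_eq <| hazardPrimitive_sub_le h₁.feasible hf₂
      hi₁ hi₂ (congrArg (A.value i) hl) hy fun z hz hz' =>
        (hb.bidRate_le h₁ h₂ hr₁ hr₂ (hy₁.trans_lt hz) hz').1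
  · rw [extendF_of_notMem hi₁, mul_comm]
    exact mul_le_mul_of_nonneg_left (h₂.extendF_le hr₂.1 (hy.trans_eq hb.bid_eq.symm) i)
      (h₁.F_pos i).le

/-- `G_i` at the level just below that of `s₁` separates the two: `s₂` is already at or under it,
and `s₁` cannot cross it before its next change. -/
theorem F_le_extendF_of_level_lt (h₁ : A.IsValid s₁) (h₂ : A.IsValid s₂)
    (hr₁ : Running s₁) (hy₁ : A.nextBid s₁ ≤ y)
    (hy : y < s₁.bid) (hl : s₂.level i < s₁.level i) : s₂.F i ≤ A.extendF s₁ y i :=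
  (h₂.F_le_cdf i).trans ((A.cdf_le_cdf (by omega) ((Nat.sub_le _ _).trans (h₁.level_le i))).trans
    (h₁.cdf_le_extendF hr₁ hy₁ hy i))

theorem IsBelow.extendF_le (hb : IsBelow s₂ s₁) (h₁ : A.IsValid s₁) (h₂ : A.IsValid s₂)
    (hr₁ : Running s₁) (hr₂ : Running s₂) (hy₁ : A.nextBid s₁ ≤ y) (hy : y < s₁.bid) (i : Fin n) :
    A.extendF s₂ y i ≤ A.extendF s₁ y i := by
  rcases (h₁.level_le_level h₂ (hb.F_le i)).eq_or_lt with hl | hl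
  · have h := hb.extendF_mul_le h₁ h₂ hr₁ hr₂ hy₁ hy hl
    exact le_of_mul_le_mul_right (h.trans (mul_le_mul_of_nonneg_left (hb.F_le i)
      (h₁.extendF_pos y i).le)) (h₁.F_pos i)
  · exact (h₂.extendF_le hr₂.1 (hy.trans_eq hb.bid_eq.symm) i).trans
      (F_le_extendF_of_level_lt h₁ h₂ hr₁ hy₁ hy hl)

theorem IsBelow.extendF_lt (hb : IsBelow s₂ s₁) (h₁ : A.IsValid s₁) (h₂ : A.IsValid s₂)
    (hr₁ : Running s₁) (hr₂ : Running s₂) (hy₁ : A.nextBid s₁ ≤ y) (hy : y < s₁.bid)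
    (hi : i ∈ s₂.bidders) (h : s₂.F i < s₁.F i ∨ ∃ u, A.IsAhead s₂ s₁ u) :
    A.extendF s₂ y i < A.extendF s₁ y i := by
  have hlt := h₂.extendF_lt hr₂.1 hi (hy.trans_eq hb.bid_eq.symm)
  rcases (h₁.level_le_level h₂ (hb.F_le i)).eq_or_lt with hl | hl
  · refine lt_of_mul_lt_mul_right ?_ (h₁.F_pos i).le
    rcases h with h | h
    · exact (hb.extendF_mul_le h₁ h₂ hr₁ hr₂ hy₁ hy hl).trans_lt
        (mul_lt_mul_of_pos_left h (h₁.extendF_pos y i))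
    by_cases hi₁ : i ∈ s₁.bidders
    · have hf₂ := h₂.feasible
      rw [hb.bid_eq] at hf₂
      refine (extendF_mul_lt_of_hazardPrimitive_sub_lt h₁ h₂ hi₁ hi hb.bid_eq <| hazardPrimitive_sub_lt h₁.feasible hf₂
        hi₁ hi (congrArg (A.value i) hl) hy fun z hz hz' =>
          (hb.bidRate_le h₁ h₂ hr₁ hr₂ (hy₁.trans_lt hz) hz').2 h).trans_le ?_
      exact mul_le_mul_of_nonneg_left (hb.F_le i) (h₁.extendF_pos y i).le
    -- A buyer waiting in `s₁` has constant `F` there, while it falls strictly in `s₂`.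
    · rw [extendF_of_notMem hi₁]
      exact mul_lt_mul_of_pos_right (hlt.trans_le (hb.F_le i)) (h₁.F_pos i)
  · exact hlt.trans_le (F_le_extendF_of_level_lt h₁ h₂ hr₁ hy₁ hy hl)

variable (A) in
/-- The state `s₂` lies so far below `s₁` that two of its bidders have strictly smaller distribution
functions at all smaller bids. -/
def IsStrictlyBelow (s₂ s₁ : ShootState n) : Prop :=
  (∃ i ∈ s₂.bidders, ∃ j ∈ s₂.bidders, i ≠ j ∧ s₂.F i < s₁.F i ∧ s₂.F j < s₁.F j) ∨
    ∃ u, A.IsAhead s₂ s₁ u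

theorem IsBelow.exists_pair_extendF_lt (hb : IsBelow s₂ s₁) (h : A.IsStrictlyBelow s₂ s₁)
    (h₁ : A.IsValid s₁) (h₂ : A.IsValid s₂) (hr₁ : Running s₁) (hr₂ : Running s₂)
    (hy₁ : A.nextBid s₁ ≤ y) (hy : y < s₁.bid) :
    ∃ i ∈ s₂.bidders, ∃ j ∈ s₂.bidders, i ≠ j ∧ A.extendF s₂ y i < A.extendF s₁ y i ∧
      A.extendF s₂ y j < A.extendF s₁ y j := by
  rcases h with ⟨i, hi, j, hj, hij, hFi, hFj⟩ | h
  · exact ⟨i, hi, j, hj, hij, hb.extendF_lt h₁ h₂ hr₁ hr₂ hy₁ hy hi (Or.inl hFi),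
      hb.extendF_lt h₁ h₂ hr₁ hr₂ hy₁ hy hj (Or.inl hFj)⟩
  · obtain ⟨i, hi, j, hj, hij⟩ := Finset.one_lt_card.1 hr₂.1
    exact ⟨i, hi, j, hj, hij, hb.extendF_lt h₁ h₂ hr₁ hr₂ hy₁ hy hi (Or.inr h),
      hb.extendF_lt h₁ h₂ hr₁ hr₂ hy₁ hy hj (Or.inr h)⟩

/-- The bound holds for the level before any departure at `y`: a leaver sits exactly on the
threshold, and the strictly larger `F` in `s₁` has not yet reached it. -/
theorem IsValid.level_le_of_extendF_lt (h₁ : A.IsValid s₁) (hs : A.IsValid s)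
    (hm : A.IsValid (A.moveTo s y)) (h : A.extendF s y i < s₁.F i) :
    s.level i ≤ s₁.level i := by
  by_cases hl : A.LeavesAt s y i
  · have h1 := h₁.F_le_cdf i
    by_contra! hlt
    have := A.cdf_le_cdf (i := i) (show s₁.level i ≤ s.level i - 1 by omega)
      ((Nat.sub_le _ _).trans (hs.level_le i))
    rw [hl.2] at h
    linarith
  · have := h₁.level_le_level hm (i := i) h.le
    exact (levelAt_of_not_leavesAt hl).ge.trans this

/-- A state in which two bidders of `s` have larger distribution functions is running as long as
`s` is, and `s` is still strictly below it after the next change of the bidding set. -/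
theorem IsValid.isStrictlyBelow_moveTo (h₁ : A.IsValid s₁) (hs : A.IsValid s) (hr : Running s)
    (hy : A.nextBid s ≤ s₁.bid) (hy' : s₁.bid < s.bid)
    (h : ∃ i ∈ s.bidders, ∃ j ∈ s.bidders, i ≠ j ∧ A.extendF s s₁.bid i < s₁.F i ∧
      A.extendF s s₁.bid j < s₁.F j) :
    2 ≤ s₁.bidders.card ∧ (2 ≤ (A.moveTo s s₁.bid).bidders.card →
      A.IsStrictlyBelow (A.moveTo s s₁.bid) s₁) := by
  have hm := hs.moveTo hr hy hy'
  have hcur : ∀ i, A.extendF s s₁.bid i < s₁.F i → A.cur s i ≤ A.cur s₁ i := fun i hi =>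
    h₁.cur_le_cur hs (h₁.level_le_of_extendF_lt hs hm hi)
  obtain ⟨i, hi, j, hj, hij, hFi, hFj⟩ := h
  refine ⟨two_le_card_of_isSaturated h₁.saturated hij
    ((hy'.trans (hs.feasible.lt i hi)).trans_le (hcur i hFi))
    ((hy'.trans (hs.feasible.lt j hj)).trans_le (hcur j hFj)), fun hc => ?_⟩
  have hahead : ∀ u ∈ s.bidders, A.extendF s s₁.bid u < s₁.F u → A.LeavesAt s s₁.bid u →
      A.IsAhead (A.moveTo s s₁.bid) s₁ u := by
    intro u hu hFu hl
    have hlt : s₁.bid < A.cur s u := hy'.trans (hs.feasible.lt u hu)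
    refine ⟨?_, hlt.trans_le (hcur u hFu), (inv_le_bidRate_iff hc).2 ?_⟩
    · change A.levelAt s s₁.bid u < _
      have h1 := hs.one_le_level u
      have h2 := h₁.level_le_of_extendF_lt hs hm hFu
      rw [levelAt_of_leavesAt hl]
      omega
    · refine le_trans (mul_le_mul_of_nonneg_left ?_ (cast_card_sub_one_pos hc).le)
        (hs.card_sub_one_mul_le_moveTo hr hy' hu)
      exact inv_anti₀ (sub_pos.2 hlt) (sub_le_sub_right (hcur u hFu) _)
  -- A leaver of the pair is ahead in `s₁`, since only `s` has used up his value; if both stay, they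
  -- remain the strict pair.
  by_cases hli : A.LeavesAt s s₁.bid i
  · exact Or.inr ⟨i, hahead i hi hFi hli⟩
  by_cases hlj : A.LeavesAt s s₁.bid j
  · exact Or.inr ⟨j, hahead j hj hFj hlj⟩
  exact Or.inl ⟨i, subset_addBuyers (mem_stayersAt.2 ⟨hi, hli⟩),
    j, subset_addBuyers (mem_stayersAt.2 ⟨hj, hlj⟩), hij, hFi, hFj⟩

end Auction

end

/-! ### Comparing the outcomes of two guesses -/

noncomputable section
namespace Auction

variable {n : ℕ} {A : Auction n} {s s₁ s₂ : ShootState n} {g g₁ g₂ : ℝ}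

theorem IsValid.endState_bid_eq_zero (hs : A.IsValid s)
    (hc : 2 ≤ (A.endState s).bidders.card) : (A.endState s).bid = 0 :=
  le_antisymm (not_lt.1 fun h => hs.not_running_endState ⟨hc, h⟩) hs.endState_spec.1.bid_nonneg

/-- The outcome `f₂` of the algorithm is larger than the outcome `f₁`. -/
def IsLargerOutcome (f₂ f₁ : ShootState n) : Prop :=
  2 ≤ f₂.bidders.card ∧ 2 ≤ f₁.bidders.card ∨
    f₂.bidders.card ≤ 1 ∧ (2 ≤ f₁.bidders.card ∨ f₁.bid < f₂.bid)

theorem isLargerOutcome_of_two_le (h : 2 ≤ s₁.bidders.card) : IsLargerOutcome s₂ s₁ := by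
  unfold IsLargerOutcome
  omega

/-- Both runs move to the higher of their next bids, where at least one changes if it is positive,
so the total potential drops. The invariant survives until bid `0` is reached or `s₂` has at most
one bidder. -/
theorem IsBelow.isLargerOutcome (hb : IsBelow s₂ s₁) (h₁ : A.IsValid s₁) (h₂ : A.IsValid s₂)
    (hc : 2 ≤ s₁.bidders.card) (h : 2 ≤ s₂.bidders.card → A.IsStrictlyBelow s₂ s₁) :
    IsLargerOutcome (A.endState s₂) (A.endState s₁) := by
  induction hp : potential s₁ + potential s₂ using Nat.strong_induction_on
    generalizing s₁ s₂ with
  | _ p ih =>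
    rcases h₁.bid_nonneg.eq_or_lt with h0 | hpos
    · rw [endState_of_not_running (s := s₁) fun hr => hr.2.ne h0]
      exact isLargerOutcome_of_two_le hc
    have hr₁ : Running s₁ := ⟨hc, hpos⟩
    by_cases hc₂ : 2 ≤ s₂.bidders.card
    swap
    · rw [endState_of_not_running (s := s₂) fun hr => hc₂ hr.1]
      -- Here `s₂` stops at the common bid, while `s₁` makes at least one more step down.
      exact Or.inr ⟨by omega, Or.inr ((h₁.endState_bid_lt hr₁).trans_eq hb.bid_eq.symm)⟩
    have hr₂ : Running s₂ := ⟨hc₂, hb.bid_eq ▸ hpos⟩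
    set y := max (A.nextBid s₁) (A.nextBid s₂) with hy
    have hy₁ : A.nextBid s₁ ≤ y := le_max_left _ _
    have hy₂ : A.nextBid s₂ ≤ y := le_max_right _ _
    have hlt₁ : y < s₁.bid := max_lt (h₁.nextBid_lt hr₁) (hb.bid_eq ▸ h₂.nextBid_lt hr₂)
    have hlt₂ : y < s₂.bid := hlt₁.trans_eq hb.bid_eq.symm
    have hm₁ := h₁.moveTo hr₁ hy₁ hlt₁
    have hm₂ := h₂.moveTo hr₂ hy₂ hlt₂
    have hb' : IsBelow (A.moveTo s₂ y) (A.moveTo s₁ y) :=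
      ⟨rfl, hb.extendF_le h₁ h₂ hr₁ hr₂ hy₁ hlt₁⟩
    -- Here `s₁` has already moved to `y` and `s₂` has not: a strict pair among the old bidders of
    -- `s₂` keeps two bidders in `s₁`.
    obtain ⟨hc', hs'⟩ := hm₁.isStrictlyBelow_moveTo h₂ hr₂ hy₂ hlt₂
      (hb.exists_pair_extendF_lt (h hc₂) h₁ h₂ hr₁ hr₂ hy₁ hlt₁)
    rw [← h₁.endState_moveTo hr₁ hy₁ hlt₁, ← h₂.endState_moveTo hr₂ hy₂ hlt₂]
    rcases hm₁.bid_nonneg.eq_or_lt with h0 | hpos'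
    · rw [endState_of_not_running (s := A.moveTo s₁ y) fun hr => hr.2.ne h0]
      exact isLargerOutcome_of_two_le hc'
    · refine ih _ ?_ hb' hm₁ hm₂ hc' hs' rfl
      have hle₁ := h₁.potential_moveTo_le y
      have hle₂ := h₂.potential_moveTo_le y
      have hpos'' : 0 < y := hpos'
      rcases max_choice (A.nextBid s₁) (A.nextBid s₂) with he | he
      · rw [← hy] at he
        have := h₁.potential_moveTo_nextBid_lt hr₁ (he ▸ hpos'')
        rw [← he] at this
        omega
      · rw [← hy] at he
        have := h₂.potential_moveTo_nextBid_lt hr₂ (he ▸ hpos'')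
        rw [← he] at this
        omega

/-- Either the loop is left above the bid `g`, or it passes through a state from which `g` is
reached before the next change of the bidding set. -/
theorem IsValid.exists_nextBid_le (hs : A.IsValid s) (hr : Running s) (hg : 0 ≤ g)
    (hlt : g < s.bid) :
    ((A.endState s).bidders.card ≤ 1 ∧ g < (A.endState s).bid) ∨
      ∃ p, A.IsValid p ∧ Running p ∧ A.nextBid p ≤ g ∧ g < p.bid ∧
        A.endState p = A.endState s ∧ ∀ i, p.F i ≤ s.F i := by
  induction hp : potential s using Nat.strong_induction_on generalizing s with
  | _ p ih =>
    by_cases hn : A.nextBid s ≤ g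
    · exact Or.inr ⟨s, hs, hr, hn, hlt, rfl, fun _ => le_rfl⟩
    rw [not_le] at hn
    by_cases hr' : Running (A.step s)
    · have h := ih _ (hp ▸ hs.potential_moveTo_nextBid_lt hr (hg.trans_lt hn)) (hs.step hr) hr' hn
        rfl
      rw [← hs.endState_step hr]
      refine h.imp_right ?_
      rintro ⟨q, hq, hrq, hnq, hgq, he, hF⟩
      exact ⟨q, hq, hrq, hnq, hgq, he,
        fun i => (hF i).trans (hs.extendF_le hr.1 (hs.nextBid_lt hr) i)⟩
    · rw [← hs.endState_step hr, endState_of_not_running hr']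
      refine Or.inl ⟨?_, hn⟩
      by_contra! hc
      exact hr' ⟨hc, hg.trans_lt hn⟩

/-- Either the run from `g₂` stops above `g₁`, or it reaches `g₁` from a state whose bidders, at
least two, arrive with `F < 1`, the value from which the run of `g₁` starts. -/
theorem isLargerOutcome_final (h0 : 0 ≤ g₁) (hlt : g₁ < g₂) :
    IsLargerOutcome (A.final g₂) (A.final g₁) := by
  have h₁ := A.isValid_start h0
  have h₂ := A.isValid_start (h0.trans hlt.le)
  change IsLargerOutcome (A.endState (A.start g₂)) (A.endState (A.start g₁))
  have hle : (A.endState (A.start g₁)).bid ≤ g₁ := h₁.endState_spec.2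
  by_cases hr₂ : Running (A.start g₂)
  swap
  · rw [endState_of_not_running hr₂]
    refine Or.inr ⟨?_, Or.inr (hle.trans_lt hlt)⟩
    by_contra! hc
    exact hr₂ ⟨hc, h0.trans_lt hlt⟩
  rcases h₂.exists_nextBid_le hr₂ h0 hlt with ⟨hc, hg⟩ | ⟨p, hp, hrp, hnp, hgp, he, hF⟩
  · exact Or.inr ⟨hc, Or.inr (hle.trans_lt hg)⟩
  have hF' : ∀ i ∈ p.bidders, A.extendF p g₁ i < (A.start g₁).F i := fun i hi =>
    (hp.extendF_lt hrp.1 hi hgp).trans_le (hF i)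
  obtain ⟨i, hi, j, hj, hij⟩ := Finset.one_lt_card.1 hrp.1
  obtain ⟨hc, hs⟩ := h₁.isStrictlyBelow_moveTo hp hrp hnp hgp
    ⟨i, hi, j, hj, hij, hF' i hi, hF' j hj⟩
  rw [← he, ← hp.endState_moveTo hrp hnp hgp]
  exact IsBelow.isLargerOutcome
    ⟨rfl, fun i => (hp.extendF_le hrp.1 hgp i).trans (hF i)⟩ h₁ (hp.moveTo hrp hnp hgp) hc hs

variable (A) in
theorem terminates (hg : 0 ≤ g) : A.Terminates g := (A.isValid_start hg).halts

theorem lowBid_eq_zero (hg : 0 ≤ g) (hc : 2 ≤ (A.final g).bidders.card) : A.lowBid g = 0 :=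
  (A.isValid_start hg).endState_bid_eq_zero hc

theorem lowBid_lt_lowBid (h0 : 0 ≤ g₁) (hlt : g₁ < g₂) (hpos : 0 < A.lowBid g₂) :
    A.lowBid g₁ < A.lowBid g₂ := by
  rcases A.isLargerOutcome_final h0 hlt with ⟨hc, -⟩ | ⟨-, hc | h⟩
  · exact absurd (lowBid_eq_zero (h0.trans hlt.le) hc) hpos.ne'
  · rwa [lowBid_eq_zero h0 hc]
  · exact h

variable (A) in
theorem strictMonoOn_lowBid : StrictMonoOn A.lowBid {g : ℝ | 0 ≤ g ∧ A.Stops g} := by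
  rintro g₁ ⟨h0, -, hc₁⟩ g₂ ⟨-, -, hc₂⟩ hlt
  rcases A.isLargerOutcome_final h0 hlt with ⟨hc, -⟩ | ⟨-, hc | h⟩
  · omega
  · omega
  · exact h

end Auction

end

theorem mainTheorem9 {n : ℕ} (A : Auction n) :
    -- the algorithm terminates on every guess
    (∀ g : ℝ, 0 ≤ g → A.Terminates g) ∧
    -- the position where it stops is strictly monotone in the guess
    StrictMonoOn A.lowBid {g : ℝ | 0 ≤ g ∧ A.Stops g} ∧
    -- the guesses on which it does not stop above bid zero lie below all others and end at zero
    (∀ g₁ g₂ : ℝ, 0 ≤ g₁ → g₁ < g₂ → A.Stops g₁ → A.Stops g₂) ∧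
    (∀ g : ℝ, 0 ≤ g → ¬ A.Stops g → A.lowBid g = 0) ∧
    -- the output is strictly monotone among all guesses wherever it is positive
    (∀ g₁ g₂ : ℝ, 0 ≤ g₁ → g₁ < g₂ → 0 < A.lowBid g₂ → A.lowBid g₁ < A.lowBid g₂) ∧
    -- at most one guess can match a given smallest winning bid
    (∀ β : ℝ, 0 < β → {g : ℝ | 0 ≤ g ∧ A.lowBid g = β}.Subsingleton) ∧
    (∀ β : ℝ, {g : ℝ | 0 ≤ g ∧ A.Stops g ∧ A.lowBid g = β}.Subsingleton) := by
  refine ⟨fun g hg => A.terminates hg, A.strictMonoOn_lowBid, ?_, ?_,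
    fun g₁ g₂ => Auction.lowBid_lt_lowBid, ?_, ?_⟩
  · intro g₁ g₂ h0 hlt h₁
    refine ⟨A.terminates (h0.trans hlt.le), ?_⟩
    have hc := h₁.2
    rcases A.isLargerOutcome_final h0 hlt with h | h
    · omega
    · exact h.1
  · intro g hg hs
    refine Auction.lowBid_eq_zero hg ?_
    by_contra! hc
    exact hs ⟨A.terminates hg, Nat.le_of_lt_succ hc⟩
  · rintro β hβ g₁ ⟨h₁, e₁⟩ g₂ ⟨h₂, e₂⟩
    rcases lt_trichotomy g₁ g₂ with hlt | heq | hlt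
    · exact absurd (e₁.trans e₂.symm) (Auction.lowBid_lt_lowBid h₁ hlt (e₂ ▸ hβ)).ne
    · exact heq
    · exact absurd (e₂.trans e₁.symm) (Auction.lowBid_lt_lowBid h₂ hlt (e₁ ▸ hβ)).ne
  · rintro β g₁ ⟨h₁, hs₁, e₁⟩ g₂ ⟨h₂, hs₂, e₂⟩
    exact A.strictMonoOn_lowBid.injOn ⟨h₁, hs₁⟩ ⟨h₂, hs₂⟩ (e₁.trans e₂.symm)
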